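/- Let $K$ be an algebraically closed field of characteristic zero with an involutive automorphism $z\mapsto\overline z$ that inverts all roots of unity, and fix pairs $(p_1,q_1),\dots,(p_r,q_r)\in\mathbb N^2$. An \emph{adequate graph} is a directed graph (loops and multiple edges allowed) with vertex colors in $\{1,\dots,r\}$ and an output color and an input color on each edge, such that at every vertex of color $a$ the output colors number the outgoing edges bijectively by $1,\dots,p_a$ and the input colors number the incoming edges bijectively by $1,\dots,q_a$. A \emph{chromatic morphism} is a graph morphism that preserves all colors. A covering is a surjective local homeomorphism; an $n$-fold covering ($n\ge 0$) is a local homeomorphism all of whose vertex fibres have $n$ elements (for $n=0$ the source is the empty graph); coverings between adequate graphs are understood to be chromatic. A finite connected adequate graph $\Gamma_0$ is \emph{irreducible} if every chromatic morphism from $\Gamma_0$ to a connected adequate graph is an isomorphism. Let $K[X]$ be the $K$-algebra with basis the isomorphism classes of finite adequate graphs and with disjoint union as multiplication. It is $\mathbb N^r$-graded by the number of vertices of each color, and carries the sesquilinear form in which distinct classes are orthogonal and $\|\Gamma\|^2=\langle\Gamma,\Gamma\rangle=|\mathrm{Aut}(\Gamma)|$, the number of chromatic automorphisms. For an irreducible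 graph $\Gamma_0$ let $K[X]_{\Gamma_0}\subseteq K[X]$ be the subalgebra generated by the connected finite adequate graphs that cover $\Gamma_0$, and let $(K[X]_{\Gamma_0})_n$ be the span of the finite $n$-fold coverings of $\Gamma_0$. (1) The inclusions $K[X]_{\Gamma_0}\subseteq K[X]$ induce an isomorphism of algebras $\bigotimes_{\Gamma_0}K[X]_{\Gamma_0}\cong K[X]$, where $\Gamma_0$ runs over all isomorphism classes of irreducible graphs and the tensor product is spanned by pure tensors almost all of whose entries are $1$. Each $K[X]_{\Gamma_0}$ is the polynomial algebra on the isomorphism classes of connected finite adequate graphs that cover $\Gamma_0$. (2) $K[X]_{\Gamma_0}=\bigoplus_{n\ge 0}(K[X]_{\Gamma_0})_n$ is a grading of the algebra, and if $\Gamma_0$ has degree $(n_1,\dots,n_r)$ in $K[X]$, then $(K[X]_{\Gamma_0})_n$ lies in degree $(nn_1,\dots,nn_r)$ of $K[X]$. Let $v$ be a vertex of $\Gamma_0$. The group $\pi_1(\Gamma_0,v)$ is free of some finite rank $m$. Let $z_1,\dots,z_m$ be any free basis of it. Say that an $n$-fold covering $\Gamma\to\Gamma_0$ \emph{corresponds}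 to $(\sigma_1,\dots,\sigma_m)\in S_n^m$ if the fibre of $v$ can be numbered $v_1,\dots,v_n$ such that for all $i,j$ the lift of $z_i$ that starts in $v_j$ ends in $v_{\sigma_i(j)}$. Every finite $n$-fold covering corresponds to some tuple and every tuple to some finite covering, and there are linear isomorphisms $(KS_n^m)_{S_n}\cong (K[X]_{\Gamma_0})_n$, for all $n\ge 0$, that send the class of $(\sigma_1,\dots,\sigma_m)$ to the class of any covering that corresponds to it; here the coinvariants are taken for the diagonal conjugation action of $S_n$ on $S_n^m$. (3) If $\Gamma$ corresponds to $(\sigma_1,\dots,\sigma_m)\in S_n^m$, then $\|\Gamma\|^2=|\{\sigma\in S_n\mid \sigma\sigma_i=\sigma_i\sigma\text{ for all }i\}|$. (4) Under the isomorphisms of (2), the product of the classes of $(\sigma_i)\in S_{a}^m$ and $(\tau_i)\in S_{b}^m$ is the class of $((\sigma_i,\tau_i))\in S_{a+b}^m$, where $S_a\times S_b\subseteq S_{a+b}$ by juxtaposition. -/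

import Mathlib

open scoped TensorProduct

noncomputable section

/-- An adequate graph of type `((p_a, q_a))_{a < r}`: a directed graph (loops and multiple edges
allowed, possibly infinite) whose vertices are colored by `Fin r` and whose edges carry an output
color and an input color, such that at a vertex of color `a` the outgoing edges are numbered
`1, ..., p a` by the output color and the incoming edges `1, ..., q a` by the input color. -/
structure AdequateGraph {r : ℕ} (p q : Fin r → ℕ) where
  V : Type
  E : Type
  s : E → V
  t : E → V
  color : V → Fin r
  outColor : E → ℕ
  inColor : E → ℕ
  bijOn_out : ∀ v, Set.BijOn outColor {e | s e = v} (Set.Icc 1 (p (color v)))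
  bijOn_in : ∀ v, Set.BijOn inColor {e | t e = v} (Set.Icc 1 (q (color v)))

namespace AdequateGraph

variable {r : ℕ} {p q : Fin r → ℕ}

/-- Chromatic morphisms. -/
@[ext]
structure Hom (G H : AdequateGraph p q) where
  onV : G.V → H.V
  onE : G.E → H.E
  map_s : ∀ e, onV (G.s e) = H.s (onE e)
  map_t : ∀ e, onV (G.t e) = H.t (onE e)
  map_color : ∀ v, H.color (onV v) = G.color v
  map_outColor : ∀ e, H.outColor (onE e) = G.outColor e
  map_inColor : ∀ e, H.inColor (onE e) = G.inColor e

namespace Hom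

variable {G H L : AdequateGraph p q}

/-- A morphism is an isomorphism when it is bijective on vertices and on edges. -/
def IsIso (φ : Hom G H) : Prop :=
  Function.Bijective φ.onV ∧ Function.Bijective φ.onE

/-- Local homeomorphism of graphs: at each vertex, the outgoing edges are mapped bijectively onto
the outgoing edges at the image, and likewise for the incoming edges. -/
def IsLocalIso (φ : Hom G H) : Prop :=
  ∀ v, Set.BijOn φ.onE {e | G.s e = v} {e | H.s e = φ.onV v} ∧
    Set.BijOn φ.onE {e | G.t e = v} {e | H.t e = φ.onV v}

/-- Coverings: surjective local homeomorphisms. -/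
def IsCovering (φ : Hom G H) : Prop :=
  Function.Surjective φ.onV ∧ Function.Surjective φ.onE ∧ φ.IsLocalIso

/-- `n`-fold coverings: local homeomorphisms all of whose vertex fibres have exactly `n` elements
(for `n = 0` this is the empty graph). -/
def IsFold (φ : Hom G H) (n : ℕ) : Prop :=
  φ.IsLocalIso ∧ ∀ w, {v | φ.onV v = w}.Finite ∧ {v | φ.onV v = w}.ncard = n

protected def id (G : AdequateGraph p q) : Hom G G :=
  ⟨id, id, fun _ => rfl, fun _ => rfl, fun _ => rfl, fun _ => rfl, fun _ => rfl⟩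

protected def comp (ψ : Hom H L) (φ : Hom G H) : Hom G L where
  onV := ψ.onV ∘ φ.onV
  onE := ψ.onE ∘ φ.onE
  map_s e := by simp [φ.map_s, ψ.map_s]
  map_t e := by simp [φ.map_t, ψ.map_t]
  map_color v := by simp [φ.map_color, ψ.map_color]
  map_outColor e := by simp [φ.map_outColor, ψ.map_outColor]
  map_inColor e := by simp [φ.map_inColor, ψ.map_inColor]

protected def inv (φ : Hom G H) (h : φ.IsIso) : Hom H G where
  onV := (Equiv.ofBijective φ.onV h.1).symm
  onE := (Equiv.ofBijective φ.onE h.2).symm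
  map_s e := by
    rw [Equiv.symm_apply_eq, Equiv.ofBijective_apply, φ.map_s]
    exact congrArg H.s ((Equiv.ofBijective φ.onE h.2).apply_symm_apply e).symm
  map_t e := by
    rw [Equiv.symm_apply_eq, Equiv.ofBijective_apply, φ.map_t]
    exact congrArg H.t ((Equiv.ofBijective φ.onE h.2).apply_symm_apply e).symm
  map_color v := by
    rw [← φ.map_color]
    exact congrArg H.color ((Equiv.ofBijective φ.onV h.1).apply_symm_apply v)
  map_outColor e := by
    rw [← φ.map_outColor]
    exact congrArg H.outColor ((Equiv.ofBijective φ.onE h.2).apply_symm_apply e)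
  map_inColor e := by
    rw [← φ.map_inColor]
    exact congrArg H.inColor ((Equiv.ofBijective φ.onE h.2).apply_symm_apply e)

theorem IsIso.id (G : AdequateGraph p q) : (Hom.id G).IsIso :=
  ⟨Function.bijective_id, Function.bijective_id⟩

theorem IsIso.comp {ψ : Hom H L} {φ : Hom G H} (hψ : ψ.IsIso) (hφ : φ.IsIso) :
    (ψ.comp φ).IsIso :=
  ⟨hψ.1.comp hφ.1, hψ.2.comp hφ.2⟩

theorem IsIso.inv {φ : Hom G H} (h : φ.IsIso) : (φ.inv h).IsIso :=
  ⟨(Equiv.ofBijective φ.onV h.1).symm.bijective, (Equiv.ofBijective φ.onE h.2).symm.bijective⟩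

theorem inv_comp {φ : Hom G H} (h : φ.IsIso) : (φ.inv h).comp φ = Hom.id G := by
  ext x
  · exact (Equiv.ofBijective φ.onV h.1).symm_apply_apply x
  · exact (Equiv.ofBijective φ.onE h.2).symm_apply_apply x

theorem comp_inv {φ : Hom G H} (h : φ.IsIso) : φ.comp (φ.inv h) = Hom.id H := by
  ext x
  · exact (Equiv.ofBijective φ.onV h.1).apply_symm_apply x
  · exact (Equiv.ofBijective φ.onE h.2).apply_symm_apply x

end Hom

/-- `G.IsWalk u l w`: the list `l` of directed edges is a walk from `u` to `w`; here `(e, true)`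
runs along `e` from its source to its target and `(e, false)` runs along `e` backwards. -/
def IsWalk (G : AdequateGraph p q) : G.V → List (G.E × Bool) → G.V → Prop
  | u, [], w => u = w
  | u, (e, true) :: l, w => G.s e = u ∧ G.IsWalk (G.t e) l w
  | u, (e, false) :: l, w => G.t e = u ∧ G.IsWalk (G.s e) l w

theorem IsWalk.append {G : AdequateGraph p q} {v w : G.V} {l' : List (G.E × Bool)} :
    ∀ {l : List (G.E × Bool)} {u : G.V}, G.IsWalk u l v → G.IsWalk v l' w →
      G.IsWalk u (l ++ l') w
  | [], _, h, h' => by cases h; exact h'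
  | (_, true) :: _, _, h, h' => ⟨h.1, IsWalk.append h.2 h'⟩
  | (_, false) :: _, _, h, h' => ⟨h.1, IsWalk.append h.2 h'⟩

theorem IsWalk.invRev {G : AdequateGraph p q} {w : G.V} :
    ∀ {l : List (G.E × Bool)} {u : G.V}, G.IsWalk u l w → G.IsWalk w (FreeGroup.invRev l) u
  | [], _, h => by cases h; rfl
  | (e, true) :: l, u, h => by
    have := (IsWalk.invRev h.2).append (l' := [(e, false)]) (w := u) ⟨rfl, h.1⟩
    simpa [FreeGroup.invRev] using this
  | (e, false) :: l, u, h => by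
    have := (IsWalk.invRev h.2).append (l' := [(e, true)]) (w := u) ⟨rfl, h.1⟩
    simpa [FreeGroup.invRev] using this

/-- The fundamental group of the graph at `v`: closed walks at `v` modulo insertion and deletion of
backtracking pairs `e e⁻¹`, `e⁻¹ e`, with concatenation of walks as multiplication. Since this is
free reduction of words in the edges, the homotopy class of a walk is its class in the free group
on the edges, and the fundamental group is the subgroup of classes of closed walks at `v`. -/
def fundGroup (G : AdequateGraph p q) (v : G.V) : Subgroup (FreeGroup G.E) where
  carrier := {g | ∃ l, G.IsWalk v l v ∧ FreeGroup.mk l = g}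
  one_mem' := ⟨[], rfl, rfl⟩
  mul_mem' := by
    rintro _ _ ⟨l, hl, rfl⟩ ⟨l', hl', rfl⟩
    exact ⟨l ++ l', hl.append hl', FreeGroup.mul_mk.symm⟩
  inv_mem' := by
    rintro _ ⟨l, hl, rfl⟩
    exact ⟨FreeGroup.invRev l, hl.invRev, FreeGroup.inv_mk.symm⟩

/-- Connected graphs; the empty graph is not connected. -/
def Connected (G : AdequateGraph p q) : Prop :=
  Nonempty G.V ∧ ∀ u w : G.V, ∃ l, G.IsWalk u l w

/-- A finite connected adequate graph is irreducible if every chromatic morphism from it to a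
connected adequate graph is an isomorphism. -/
def Irreducible (G : AdequateGraph p q) : Prop :=
  (Finite G.V ∧ Finite G.E) ∧ G.Connected ∧
    ∀ H : AdequateGraph p q, H.Connected → ∀ φ : Hom G H, φ.IsIso

/-- The empty graph. -/
def empty (p q : Fin r → ℕ) : AdequateGraph p q where
  V := Empty
  E := Empty
  s := Empty.elim
  t := Empty.elim
  color := Empty.elim
  outColor := Empty.elim
  inColor := Empty.elim
  bijOn_out v := v.elim
  bijOn_in v := v.elim

theorem bijOn_sum {A B C D : Type} (f : A → C) (g : B → D) (c : A → ℕ) (d : B → ℕ)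
    {P : C ⊕ D → ℕ}
    (hc : ∀ v, Set.BijOn c {e | f e = v} (Set.Icc 1 (P (Sum.inl v))))
    (hd : ∀ v, Set.BijOn d {e | g e = v} (Set.Icc 1 (P (Sum.inr v)))) (v : C ⊕ D) :
    Set.BijOn (Sum.elim c d) {e | Sum.map f g e = v} (Set.Icc 1 (P v)) := by
  rcases v with v | v
  · refine ⟨?_, ?_, ?_⟩
    · rintro (e | e) he
      · exact (hc v).mapsTo (Sum.inl_injective he)
      · exact absurd he Sum.inr_ne_inl
    · rintro (e | e) he (e' | e') he' h
      · exact congrArg Sum.inl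
          ((hc v).injOn (Sum.inl_injective he) (Sum.inl_injective he') h)
      · exact absurd he' Sum.inr_ne_inl
      · exact absurd he Sum.inr_ne_inl
      · exact absurd he Sum.inr_ne_inl
    · intro k hk
      obtain ⟨e, he, rfl⟩ := (hc v).surjOn hk
      exact ⟨Sum.inl e, congrArg Sum.inl he, rfl⟩
  · refine ⟨?_, ?_, ?_⟩
    · rintro (e | e) he
      · exact absurd he Sum.inl_ne_inr
      · exact (hd v).mapsTo (Sum.inr_injective he)
    · rintro (e | e) he (e' | e') he' h
      · exact absurd he Sum.inl_ne_inr
      · exact absurd he Sum.inl_ne_inr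
      · exact absurd he' Sum.inl_ne_inr
      · exact congrArg Sum.inr
          ((hd v).injOn (Sum.inr_injective he) (Sum.inr_injective he') h)
    · intro k hk
      obtain ⟨e, he, rfl⟩ := (hd v).surjOn hk
      exact ⟨Sum.inr e, congrArg Sum.inr he, rfl⟩

/-- Disjoint union of graphs. -/
def sum (G H : AdequateGraph p q) : AdequateGraph p q where
  V := G.V ⊕ H.V
  E := G.E ⊕ H.E
  s := Sum.map G.s H.s
  t := Sum.map G.t H.t
  color := Sum.elim G.color H.color
  outColor := Sum.elim G.outColor H.outColor
  inColor := Sum.elim G.inColor H.inColor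
  bijOn_out := bijOn_sum (P := fun v => p (Sum.elim G.color H.color v)) _ _ _ _
    G.bijOn_out H.bijOn_out
  bijOn_in := bijOn_sum (P := fun v => q (Sum.elim G.color H.color v)) _ _ _ _
    G.bijOn_in H.bijOn_in

end AdequateGraph

open AdequateGraph

/-- Finite adequate graphs, that is, closed diagrams. -/
abbrev FinGraph {r : ℕ} (p q : Fin r → ℕ) : Type 1 :=
  {G : AdequateGraph p q // Finite G.V ∧ Finite G.E}

/-- Chromatic isomorphism of finite adequate graphs. -/
instance finGraphSetoid {r : ℕ} (p q : Fin r → ℕ) : Setoid (FinGraph p q) where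
  r G H := ∃ φ : Hom G.1 H.1, φ.IsIso
  iseqv :=
    { refl := fun G => ⟨Hom.id G.1, Hom.IsIso.id G.1⟩
      symm := fun ⟨φ, h⟩ => ⟨φ.inv h, h.inv⟩
      trans := fun ⟨φ, h⟩ ⟨ψ, h'⟩ => ⟨ψ.comp φ, h'.comp h⟩ }

/-- Isomorphism classes of finite adequate graphs. -/
abbrev GraphClass {r : ℕ} (p q : Fin r → ℕ) : Type 1 := Quotient (finGraphSetoid p q)

namespace GraphClass

variable {r : ℕ} {p q : Fin r → ℕ}

/-- The isomorphism class of a finite adequate graph. -/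
abbrev mk (G : FinGraph p q) : GraphClass p q := Quotient.mk (finGraphSetoid p q) G

/-- Disjoint union of isomorphism classes. -/
def mul : GraphClass p q → GraphClass p q → GraphClass p q :=
  Quotient.map₂
    (fun G H => ⟨G.1.sum H.1, by
      have := G.2.1; have := G.2.2; have := H.2.1; have := H.2.2
      exact ⟨inferInstanceAs (Finite (G.1.V ⊕ H.1.V)), inferInstanceAs (Finite (G.1.E ⊕ H.1.E))⟩⟩)
    (by
      rintro G G' ⟨φ, hφ⟩ H H' ⟨ψ, hψ⟩
      refine ⟨⟨Sum.map φ.onV ψ.onV, Sum.map φ.onE ψ.onE, ?_, ?_, ?_, ?_, ?_⟩,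
        hφ.1.sumMap hψ.1, hφ.2.sumMap hψ.2⟩
      · rintro (e | e)
        · exact congrArg Sum.inl (φ.map_s e)
        · exact congrArg Sum.inr (ψ.map_s e)
      · rintro (e | e)
        · exact congrArg Sum.inl (φ.map_t e)
        · exact congrArg Sum.inr (ψ.map_t e)
      · rintro (v | v)
        · exact φ.map_color v
        · exact ψ.map_color v
      · rintro (e | e)
        · exact φ.map_outColor e
        · exact ψ.map_outColor e
      · rintro (e | e)
        · exact φ.map_inColor e
        · exact ψ.map_inColor e)

/-- Isomorphism classes form a commutative monoid under disjoint union, with the empty graph as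
unit. -/
instance : CommMonoid (GraphClass p q) where
  mul := mul
  one := mk ⟨AdequateGraph.empty p q, inferInstanceAs (Finite Empty), inferInstanceAs (Finite Empty)⟩
  mul_assoc := by
    rintro ⟨A⟩ ⟨B⟩ ⟨C⟩
    refine Quotient.sound ⟨⟨Equiv.sumAssoc A.1.V B.1.V C.1.V, Equiv.sumAssoc A.1.E B.1.E C.1.E,
      ?_, ?_, ?_, ?_, ?_⟩, Equiv.bijective _, Equiv.bijective _⟩ <;>
    rintro ((x | x) | x) <;> rfl
  mul_comm := by
    rintro ⟨A⟩ ⟨B⟩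
    refine Quotient.sound ⟨⟨Equiv.sumComm A.1.V B.1.V, Equiv.sumComm A.1.E B.1.E,
      ?_, ?_, ?_, ?_, ?_⟩, Equiv.bijective _, Equiv.bijective _⟩ <;>
    rintro (x | x) <;> rfl
  one_mul := by
    rintro ⟨A⟩
    refine Quotient.sound ⟨⟨Equiv.emptySum Empty A.1.V, Equiv.emptySum Empty A.1.E,
      ?_, ?_, ?_, ?_, ?_⟩, Equiv.bijective _, Equiv.bijective _⟩ <;>
    rintro (x | x) <;> first | exact x.elim | rfl
  mul_one := by
    rintro ⟨A⟩
    refine Quotient.sound ⟨⟨Equiv.sumEmpty A.1.V Empty, Equiv.sumEmpty A.1.E Empty,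
      ?_, ?_, ?_, ?_, ?_⟩, Equiv.bijective _, Equiv.bijective _⟩ <;>
    rintro (x | x) <;> first | exact x.elim | rfl

/-- The order of the group of chromatic automorphisms. -/
def autCard : GraphClass p q → ℕ :=
  Quotient.lift (fun G => Nat.card {φ : Hom G.1 G.1 // φ.IsIso}) (by
    rintro G H ⟨φ, h⟩
    refine Nat.card_congr
      { toFun := fun α => ⟨φ.comp (α.1.comp (φ.inv h)), h.comp (α.2.comp h.inv)⟩
        invFun := fun β => ⟨(φ.inv h).comp (β.1.comp φ), h.inv.comp (β.2.comp h)⟩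
        left_inv := fun α => Subtype.ext ?_
        right_inv := fun β => Subtype.ext ?_ }
    · change (((φ.inv h).comp φ).comp α.1).comp ((φ.inv h).comp φ) = α.1
      rw [Hom.inv_comp]; rfl
    · change ((φ.comp (φ.inv h)).comp β.1).comp (φ.comp (φ.inv h)) = β.1
      rw [Hom.comp_inv]; rfl)

/-- The isomorphism classes of connected graphs that cover a graph in the class `c₀`. -/
def connectedCovers (c₀ : GraphClass p q) : Set (GraphClass p q) :=
  {c | ∃ Γ Γ₀ : FinGraph p q, mk Γ = c ∧ mk Γ₀ = c₀ ∧ Γ.1.Connected ∧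
    ∃ φ : Hom Γ.1 Γ₀.1, φ.IsCovering}

end GraphClass

/-- The isomorphism classes of irreducible graphs. -/
abbrev IrrClass {r : ℕ} (p q : Fin r → ℕ) : Type 1 :=
  {c : GraphClass p q // ∃ Γ₀ : FinGraph p q, Γ₀.1.Irreducible ∧ GraphClass.mk Γ₀ = c}

/-- The tensor product of an arbitrary family of commutative algebras over a field: inside the full
multilinear tensor product, the span of the pure tensors almost all of whose entries are `1`, that
is, the subalgebra generated by the images of the factors. -/
def algTensor (K : Type*) [Field K] {ι : Type*} (A : ι → Type*) [∀ i, CommRing (A i)]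
    [∀ i, Algebra K (A i)] : Subalgebra K (⨂[K] i, A i) :=
  open Classical in ⨆ i, (PiTensorProduct.singleAlgHom (R := K) (A := A) i).range

/-- The inclusion of a factor, `a ↦ a ⊗ 1 ⊗ 1 ⊗ ⋯`. -/
def algTensor.incl (K : Type*) [Field K] {ι : Type*} (A : ι → Type*) [∀ i, CommRing (A i)]
    [∀ i, Algebra K (A i)] (i : ι) : A i →ₐ[K] algTensor K A :=
  open Classical in
  (PiTensorProduct.singleAlgHom (R := K) (A := A) i).codRestrict (algTensor K A) (fun a =>
    le_iSup (fun i => (PiTensorProduct.singleAlgHom (R := K) (A := A) i).range) i ⟨a, rfl⟩)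

/-- The universal ring of invariants `K[X]`: it has the closed diagrams (isomorphism classes of
finite adequate graphs) as a basis, multiplied by disjoint union. -/
abbrev KX (K : Type*) [Field K] {r : ℕ} (p q : Fin r → ℕ) : Type _ :=
  MonoidAlgebra K (GraphClass p q)

namespace KX

variable (K : Type*) [Field K] {r : ℕ} {p q : Fin r → ℕ}

/-- The basis element of `K[X]` given by a finite graph. -/
def diag (Γ : FinGraph p q) : KX K p q := MonoidAlgebra.of K _ (GraphClass.mk Γ)

/-- The form `⟨∑ aᵢ Dᵢ, ∑ bᵢ Dᵢ⟩ = ∑ aᵢ conj(bᵢ) |Aut Dᵢ|` on `K[X]`. -/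
def form {K : Type*} [Field K] (conj : K ≃+* K) (x y : KX K p q) : K :=
  x.coeff.sum fun D a => a * conj (y.coeff D) * (D.autCard : K)

/-- The part of `K[X]` of degree `d ∈ ℕ^r`, spanned by the diagrams with `d a` boxes of type `a`
for each `a`. -/
def homogeneous (p q : Fin r → ℕ) (d : Fin r → ℕ) : Submodule K (KX K p q) :=
  Submodule.span K {x | ∃ Γ : FinGraph p q,
    (∀ a, {v | Γ.1.color v = a}.ncard = d a) ∧ diag K Γ = x}

/-- `K[X]_{Γ₀}`: the subalgebra generated by the connected graphs covering `Γ₀`. -/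
def piece (c₀ : GraphClass p q) : Subalgebra K (KX K p q) :=
  Algebra.adjoin K (MonoidAlgebra.of K (GraphClass p q) '' c₀.connectedCovers)

/-- `(K[X]_{Γ₀})_n`: the span of the `n`-fold coverings of `Γ₀`. -/
def gradedPiece (c₀ : GraphClass p q) (n : ℕ) : Submodule K (piece K c₀) :=
  Submodule.span K {x | ∃ Γ Γ₀ : FinGraph p q, GraphClass.mk Γ₀ = c₀ ∧
    (∃ φ : Hom Γ.1 Γ₀.1, φ.IsFold n) ∧ (x : KX K p q) = diag K Γ}

end KX

/-- The representation of `S_n` on the group algebra `K S_n^m` by diagonal conjugation. -/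
def diagConj (K : Type*) [Field K] (m n : ℕ) :
    Representation K (Equiv.Perm (Fin n)) (MonoidAlgebra K (Fin m → Equiv.Perm (Fin n))) :=
  (Representation.ofMulAction K (ConjAct (Equiv.Perm (Fin n)))
    (Fin m → Equiv.Perm (Fin n))).comp ConjAct.toConjAct.toMonoidHom

/-- The class of a tuple of permutations in the coinvariants `(K S_n^m)_{S_n}`. -/
def tupleClass (K : Type*) [Field K] {m n : ℕ} (σ : Fin m → Equiv.Perm (Fin n)) :
    (diagConj K m n).Coinvariants :=
  Representation.Coinvariants.mk (diagConj K m n) (MonoidAlgebra.of K _ σ)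

/-- Juxtaposition `S_a × S_b ⊆ S_{a+b}`. -/
def juxtapose {a b : ℕ} (σ : Equiv.Perm (Fin a)) (τ : Equiv.Perm (Fin b)) :
    Equiv.Perm (Fin (a + b)) :=
  finSumFinEquiv.permCongr (Equiv.sumCongr σ τ)

/-- The graph `Γ` is an `n`-fold covering `φ : Γ → Γ₀` which corresponds to the tuple `σ`, for
elements `z₁, ..., z_m` of the fundamental group of `Γ₀` at `v`: for some numbering `v₁, ..., v_n`
of the fibre of `v`, the lift of `z_i` that starts in `v_j` ends in `v_{σ_i(j)}`. -/
def CorrespondsTo {r : ℕ} {p q : Fin r → ℕ} {Γ₀ : AdequateGraph p q} {v : Γ₀.V} {m n : ℕ}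
    (z : Fin m → Γ₀.fundGroup v) (Γ : AdequateGraph p q) (σ : Fin m → Equiv.Perm (Fin n)) :
    Prop :=
  ∃ φ : Hom Γ Γ₀, φ.IsFold n ∧ ∃ f : Fin n ≃ {x : Γ.V // φ.onV x = v},
    ∀ i j, ∃ l, Γ.IsWalk (f j) l (f (σ i j)) ∧
      FreeGroup.map φ.onE (FreeGroup.mk l) = (z i : FreeGroup Γ₀.E)

end

noncomputable section

open AdequateGraph

namespace AdequateGraph

variable {r : ℕ} {p q : Fin r → ℕ}

namespace Hom

variable {G H L : AdequateGraph p q}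

theorem exists_out (φ : Hom G H) {v : G.V} {e : H.E} (he : H.s e = φ.onV v) :
    ∃ ε, G.s ε = v ∧ φ.onE ε = e := by
  have h1 : H.outColor e ∈ Set.Icc 1 (p (G.color v)) := by
    rw [← φ.map_color]
    exact (H.bijOn_out _).mapsTo he
  obtain ⟨ε, hε, hc⟩ := (G.bijOn_out v).surjOn h1
  refine ⟨ε, hε, (H.bijOn_out (φ.onV v)).injOn ?_ he ?_⟩
  · exact (φ.map_s ε).symm.trans (congrArg φ.onV hε)
  · rw [φ.map_outColor, hc]

theorem exists_in (φ : Hom G H) {v : G.V} {e : H.E} (he : H.t e = φ.onV v) :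
    ∃ ε, G.t ε = v ∧ φ.onE ε = e := by
  have h1 : H.inColor e ∈ Set.Icc 1 (q (G.color v)) := by
    rw [← φ.map_color]
    exact (H.bijOn_in _).mapsTo he
  obtain ⟨ε, hε, hc⟩ := (G.bijOn_in v).surjOn h1
  refine ⟨ε, hε, (H.bijOn_in (φ.onV v)).injOn ?_ he ?_⟩
  · exact (φ.map_t ε).symm.trans (congrArg φ.onV hε)
  · rw [φ.map_inColor, hc]

theorem eq_of_s (φ : Hom G H) {ε ε' : G.E} (hs : G.s ε = G.s ε') (h : φ.onE ε = φ.onE ε') :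
    ε = ε' :=
  (G.bijOn_out (G.s ε')).injOn hs rfl (by rw [← φ.map_outColor, h, φ.map_outColor])

theorem eq_of_t (φ : Hom G H) {ε ε' : G.E} (ht : G.t ε = G.t ε') (h : φ.onE ε = φ.onE ε') :
    ε = ε' :=
  (G.bijOn_in (G.t ε')).injOn ht rfl (by rw [← φ.map_inColor, h, φ.map_inColor])

/-- Chromatic morphisms of adequate graphs are local homeomorphisms. -/
theorem isLocalIso (φ : Hom G H) : φ.IsLocalIso := fun v =>
  ⟨⟨fun e (he : G.s e = v) => by subst he; exact (φ.map_s e).symm,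
    fun e (he : G.s e = v) e' (he' : G.s e' = v) h => φ.eq_of_s (he.trans he'.symm) h,
    fun _ he => φ.exists_out he⟩,
   ⟨fun e (he : G.t e = v) => by subst he; exact (φ.map_t e).symm,
    fun e (he : G.t e = v) e' (he' : G.t e' = v) h => φ.eq_of_t (he.trans he'.symm) h,
    fun _ he => φ.exists_in he⟩⟩

theorem surjective_onE (φ : Hom G H) (h : Function.Surjective φ.onV) :
    Function.Surjective φ.onE := fun e => by
  obtain ⟨v, hv⟩ := h (H.s e)
  obtain ⟨ε, -, hε⟩ := φ.exists_out hv.symm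
  exact ⟨ε, hε⟩

theorem injective_onE (φ : Hom G H) (h : Function.Injective φ.onV) :
    Function.Injective φ.onE := fun e e' he =>
  φ.eq_of_s (h (by rw [φ.map_s, φ.map_s, he])) he

theorem isIso_of_bijective (φ : Hom G H) (h : Function.Bijective φ.onV) : φ.IsIso :=
  ⟨h, φ.injective_onE h.1, φ.surjective_onE h.2⟩

theorem isWalk_map (φ : Hom G H) {w : G.V} : ∀ {l : List (G.E × Bool)} {u : G.V},
    G.IsWalk u l w → H.IsWalk (φ.onV u) (l.map fun x => (φ.onE x.1, x.2)) (φ.onV w)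
  | [], _, h => congrArg φ.onV h
  | (e, true) :: l, u, h =>
    ⟨(φ.map_s e).symm.trans (congrArg φ.onV h.1), by rw [← φ.map_t]; exact φ.isWalk_map h.2⟩
  | (e, false) :: l, u, h =>
    ⟨(φ.map_t e).symm.trans (congrArg φ.onV h.1), by rw [← φ.map_s]; exact φ.isWalk_map h.2⟩

theorem exists_lift (φ : Hom G H) {w : H.V} : ∀ {l : List (H.E × Bool)} {u : G.V},
    H.IsWalk (φ.onV u) l w → ∃ l' y, G.IsWalk u l' y ∧ φ.onV y = w ∧
      (l'.map fun x => (φ.onE x.1, x.2)) = l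
  | [], u, h => ⟨[], u, rfl, h, rfl⟩
  | (e, true) :: l, u, h => by
    obtain ⟨ε, rfl, rfl⟩ := φ.exists_out h.1
    obtain ⟨l', y, h1, h2, h3⟩ := φ.exists_lift (u := G.t ε) (l := l) (by rw [φ.map_t]; exact h.2)
    exact ⟨(ε, true) :: l', y, ⟨rfl, h1⟩, h2, by simp [h3]⟩
  | (e, false) :: l, u, h => by
    obtain ⟨ε, rfl, rfl⟩ := φ.exists_in h.1
    obtain ⟨l', y, h1, h2, h3⟩ := φ.exists_lift (u := G.s ε) (l := l) (by rw [φ.map_s]; exact h.2)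
    exact ⟨(ε, false) :: l', y, ⟨rfl, h1⟩, h2, by simp [h3]⟩

theorem surjective_onV (φ : Hom G H) [Nonempty G.V] (hH : H.Connected) :
    Function.Surjective φ.onV := fun w => by
  obtain ⟨l, hl⟩ := hH.2 (φ.onV (Classical.arbitrary G.V)) w
  obtain ⟨-, y, -, hy, -⟩ := φ.exists_lift hl
  exact ⟨y, hy⟩

theorem isCovering (φ : Hom G H) [Nonempty G.V] (hH : H.Connected) : φ.IsCovering :=
  ⟨φ.surjective_onV hH, φ.surjective_onE (φ.surjective_onV hH), φ.isLocalIso⟩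

theorem connected_of_surjective (φ : Hom G H) (h : Function.Surjective φ.onV)
    (hG : G.Connected) : H.Connected := by
  refine ⟨hG.1.map φ.onV, fun u w => ?_⟩
  obtain ⟨u, rfl⟩ := h u
  obtain ⟨w, rfl⟩ := h w
  obtain ⟨l, hl⟩ := hG.2 u w
  exact ⟨_, φ.isWalk_map hl⟩

/-- Two morphisms which agree at the start of a walk agree at its end. -/
theorem eq_of_isWalk (φ ψ : Hom G H) {w : G.V} : ∀ {l : List (G.E × Bool)} {u : G.V},
    G.IsWalk u l w → φ.onV u = ψ.onV u → φ.onV w = ψ.onV w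
  | [], _, h, h' => by cases h; exact h'
  | (e, true) :: l, u, h, h' => by
    refine eq_of_isWalk φ ψ h.2 ?_
    obtain ⟨rfl, -⟩ := h
    rw [φ.map_t, ψ.map_t]
    congr 1
    refine (H.bijOn_out (ψ.onV (G.s e))).injOn ?_ (ψ.map_s e).symm ?_
    · rw [← h']; exact (φ.map_s e).symm
    · rw [φ.map_outColor, ψ.map_outColor]
  | (e, false) :: l, u, h, h' => by
    refine eq_of_isWalk φ ψ h.2 ?_
    obtain ⟨rfl, -⟩ := h
    rw [φ.map_s, ψ.map_s]
    congr 1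
    refine (H.bijOn_in (ψ.onV (G.t e))).injOn ?_ (ψ.map_t e).symm ?_
    · rw [← h']; exact (φ.map_t e).symm
    · rw [φ.map_inColor, ψ.map_inColor]

/-- A morphism is determined by its map on vertices. -/
theorem ext_onV {φ ψ : Hom G H} (h : φ.onV = ψ.onV) : φ = ψ := by
  refine Hom.ext h (funext fun e => ?_)
  refine (H.bijOn_out (φ.onV (G.s e))).injOn (φ.map_s e).symm ?_ ?_
  · rw [h]; exact (ψ.map_s e).symm
  · rw [φ.map_outColor, ψ.map_outColor]

end Hom

section Restrict

/-- The full subgraph on a union of connected components. -/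
def restrict (G : AdequateGraph p q) (S : Set G.V) (hS : ∀ e, G.s e ∈ S ↔ G.t e ∈ S) :
    AdequateGraph p q where
  V := S
  E := {e // G.s e ∈ S}
  s e := ⟨G.s e.1, e.2⟩
  t e := ⟨G.t e.1, (hS e.1).1 e.2⟩
  color v := G.color v.1
  outColor e := G.outColor e.1
  inColor e := G.inColor e.1
  bijOn_out v := by
    refine ⟨fun e he => (G.bijOn_out v.1).mapsTo (congrArg Subtype.val he),
      fun e he e' he' h => Subtype.ext ((G.bijOn_out v.1).injOn (congrArg Subtype.val he)
        (congrArg Subtype.val he') h), fun k hk => ?_⟩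
    obtain ⟨e, he, rfl⟩ := (G.bijOn_out v.1).surjOn hk
    have he : G.s e = v.1 := he
    exact ⟨⟨e, he ▸ v.2⟩, Subtype.ext he, rfl⟩
  bijOn_in v := by
    refine ⟨fun e he => (G.bijOn_in v.1).mapsTo (congrArg Subtype.val he),
      fun e he e' he' h => Subtype.ext ((G.bijOn_in v.1).injOn (congrArg Subtype.val he)
        (congrArg Subtype.val he') h), fun k hk => ?_⟩
    obtain ⟨e, he, rfl⟩ := (G.bijOn_in v.1).surjOn hk
    have he : G.t e = v.1 := he
    exact ⟨⟨e, (hS e).2 (he ▸ v.2)⟩, Subtype.ext he, rfl⟩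

/-- The inclusion of a full subgraph. -/
def restrictIncl (G : AdequateGraph p q) (S : Set G.V) (hS : ∀ e, G.s e ∈ S ↔ G.t e ∈ S) :
    Hom (G.restrict S hS) G :=
  ⟨Subtype.val, Subtype.val, fun _ => rfl, fun _ => rfl, fun _ => rfl, fun _ => rfl, fun _ => rfl⟩

/-- The vertices of the connected component of a vertex. -/
def compSet (G : AdequateGraph p q) (v : G.V) : Set G.V := {w | ∃ l, G.IsWalk v l w}

theorem mem_compSet_self (G : AdequateGraph p q) (v : G.V) : v ∈ G.compSet v := ⟨[], rfl⟩

theorem compSet_closed (G : AdequateGraph p q) (v : G.V) (e : G.E) :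
    G.s e ∈ G.compSet v ↔ G.t e ∈ G.compSet v :=
  ⟨fun ⟨l, hl⟩ => ⟨l ++ [(e, true)], hl.append ⟨rfl, rfl⟩⟩,
    fun ⟨l, hl⟩ => ⟨l ++ [(e, false)], hl.append ⟨rfl, rfl⟩⟩⟩

/-- The connected component of a vertex. -/
def comp (G : AdequateGraph p q) (v : G.V) : AdequateGraph p q :=
  G.restrict (G.compSet v) (G.compSet_closed v)

/-- The inclusion of the connected component of a vertex. -/
def compIncl (G : AdequateGraph p q) (v : G.V) : Hom (G.comp v) G :=
  G.restrictIncl _ _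

theorem comp_connected (G : AdequateGraph p q) (v : G.V) : (G.comp v).Connected := by
  have key : ∀ w : (G.comp v).V, ∃ l, (G.comp v).IsWalk ⟨v, G.mem_compSet_self v⟩ l w := by
    rintro ⟨w, l, hl⟩
    obtain ⟨l', y, h1, h2, -⟩ :=
      (G.compIncl v).exists_lift (u := ⟨v, G.mem_compSet_self v⟩) (l := l) (w := w) hl
    have : y = ⟨w, l, hl⟩ := Subtype.ext h2
    exact ⟨l', this ▸ h1⟩
  refine ⟨⟨⟨v, G.mem_compSet_self v⟩⟩, fun u w => ?_⟩
  obtain ⟨l, hl⟩ := key u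
  obtain ⟨l', hl'⟩ := key w
  exact ⟨_, hl.invRev.append hl'⟩

/-- A morphism which is injective on vertices maps components isomorphically. -/
theorem Hom.exists_iso_comp {G H : AdequateGraph p q} (φ : Hom G H)
    (hφ : Function.Injective φ.onV) (v : G.V) :
    ∃ ψ : Hom (G.comp v) (H.comp (φ.onV v)), ψ.IsIso := by
  have hm : ∀ w ∈ G.compSet v, φ.onV w ∈ H.compSet (φ.onV v) :=
    fun w ⟨l, hl⟩ => ⟨_, φ.isWalk_map hl⟩
  refine ⟨⟨fun w => ⟨φ.onV w.1, hm w.1 w.2⟩, fun e => ⟨φ.onE e.1, ?_⟩, ?_, ?_, ?_, ?_, ?_⟩,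
    Hom.isIso_of_bijective _ ⟨?_, ?_⟩⟩
  · rw [← φ.map_s]; exact hm _ e.2
  · exact fun e => Subtype.ext (φ.map_s e.1)
  · exact fun e => Subtype.ext (φ.map_t e.1)
  · exact fun w => φ.map_color w.1
  · exact fun e => φ.map_outColor e.1
  · exact fun e => φ.map_inColor e.1
  · exact fun a b h => Subtype.ext (hφ (congrArg Subtype.val h))
  · rintro ⟨w, l, hl⟩
    obtain ⟨l', y, h1, h2, -⟩ := φ.exists_lift hl
    exact ⟨⟨y, l', h1⟩, Subtype.ext h2⟩

theorem Connected.compIncl_isIso {G : AdequateGraph p q} (hG : G.Connected) (v : G.V) :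
    (G.compIncl v).IsIso :=
  Hom.isIso_of_bijective _ ⟨Subtype.val_injective, fun w => ⟨⟨w, hG.2 v w⟩, rfl⟩⟩

/-- A graph is the disjoint union of a union of components and its complement. -/
theorem exists_iso_sum_restrict (G : AdequateGraph p q) (S : Set G.V)
    (hS : ∀ e, G.s e ∈ S ↔ G.t e ∈ S) :
    ∃ φ : Hom ((G.restrict S hS).sum (G.restrict Sᶜ fun e => not_congr (hS e))) G, φ.IsIso := by
  refine ⟨⟨Sum.elim Subtype.val Subtype.val, Sum.elim Subtype.val Subtype.val,
    ?_, ?_, ?_, ?_, ?_⟩, Hom.isIso_of_bijective _ ⟨?_, fun w => ?_⟩⟩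
  any_goals rintro (e | e) <;> rfl
  · rintro (⟨a, ha⟩ | ⟨a, ha⟩) (⟨b, hb⟩ | ⟨b, hb⟩) h
    · exact congrArg Sum.inl (Subtype.ext h)
    · cases (show a = b from h); exact absurd ha hb
    · cases (show a = b from h); exact absurd hb ha
    · exact congrArg Sum.inr (Subtype.ext h)
  · by_cases hw : w ∈ S
    · exact ⟨Sum.inl ⟨w, hw⟩, rfl⟩
    · exact ⟨Sum.inr ⟨w, hw⟩, rfl⟩

end Restrict

section Sum

variable {G H L : AdequateGraph p q}

def sumInl (G H : AdequateGraph p q) : Hom G (G.sum H) :=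
  ⟨Sum.inl, Sum.inl, fun _ => rfl, fun _ => rfl, fun _ => rfl, fun _ => rfl, fun _ => rfl⟩

def sumInr (G H : AdequateGraph p q) : Hom H (G.sum H) :=
  ⟨Sum.inr, Sum.inr, fun _ => rfl, fun _ => rfl, fun _ => rfl, fun _ => rfl, fun _ => rfl⟩

def Hom.sumElim (φ : Hom G L) (ψ : Hom H L) : Hom (G.sum H) L where
  onV := Sum.elim φ.onV ψ.onV
  onE := Sum.elim φ.onE ψ.onE
  map_s := by rintro (e | e); exacts [φ.map_s e, ψ.map_s e]
  map_t := by rintro (e | e); exacts [φ.map_t e, ψ.map_t e]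
  map_color := by rintro (e | e); exacts [φ.map_color e, ψ.map_color e]
  map_outColor := by rintro (e | e); exacts [φ.map_outColor e, ψ.map_outColor e]
  map_inColor := by rintro (e | e); exacts [φ.map_inColor e, ψ.map_inColor e]

def Hom.fromEmpty (L : AdequateGraph p q) : Hom (AdequateGraph.empty p q) L where
  onV := Empty.elim
  onE := Empty.elim
  map_s e := e.elim
  map_t e := e.elim
  map_color e := e.elim
  map_outColor e := e.elim
  map_inColor e := e.elim

end Sum

section Bisim

/-- Bisimulations on a graph: relations between vertices of the same color, such that equally
numbered edges at related vertices have the same colors and related other ends. -/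
def IsBisim (G : AdequateGraph p q) (S : G.V → G.V → Prop) : Prop :=
  ∀ v w, S v w → G.color v = G.color w ∧
    (∀ e e', G.s e = v → G.s e' = w → G.outColor e = G.outColor e' →
      G.inColor e = G.inColor e' ∧ S (G.t e) (G.t e')) ∧
    (∀ e e', G.t e = v → G.t e' = w → G.inColor e = G.inColor e' →
      G.outColor e = G.outColor e' ∧ S (G.s e) (G.s e'))

theorem IsBisim.eq (G : AdequateGraph p q) : G.IsBisim (· = ·) := by
  rintro v _ rfl
  refine ⟨rfl, fun e e' he he' h => ?_, fun e e' he he' h => ?_⟩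
  · cases (G.bijOn_out v).injOn he he' h; exact ⟨rfl, rfl⟩
  · cases (G.bijOn_in v).injOn he he' h; exact ⟨rfl, rfl⟩

theorem IsBisim.symm {G : AdequateGraph p q} {S : G.V → G.V → Prop} (hS : G.IsBisim S) :
    G.IsBisim (fun v w => S w v) := fun _ _ h =>
  ⟨(hS _ _ h).1.symm,
    fun e e' he he' hc => ((hS _ _ h).2.1 e' e he' he hc.symm).imp Eq.symm id,
    fun e e' he he' hc => ((hS _ _ h).2.2 e' e he' he hc.symm).imp Eq.symm id⟩

theorem IsBisim.comp {G : AdequateGraph p q} {S T : G.V → G.V → Prop} (hS : G.IsBisim S)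
    (hT : G.IsBisim T) : G.IsBisim (fun v w => ∃ x, S v x ∧ T x w) := by
  rintro v w ⟨x, h1, h2⟩
  refine ⟨(hS _ _ h1).1.trans (hT _ _ h2).1, fun e e' he he' hc => ?_, fun e e' he he' hc => ?_⟩
  · obtain ⟨e'', h3, h4⟩ := (G.bijOn_out x).surjOn
      (show G.outColor e ∈ _ from (hS _ _ h1).1 ▸ (G.bijOn_out v).mapsTo he)
    have h5 := (hS _ _ h1).2.1 e e'' he h3 h4.symm
    have h6 := (hT _ _ h2).2.1 e'' e' h3 he' (h4.trans hc)
    exact ⟨h5.1.trans h6.1, _, h5.2, h6.2⟩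
  · obtain ⟨e'', h3, h4⟩ := (G.bijOn_in x).surjOn
      (show G.inColor e ∈ _ from (hS _ _ h1).1 ▸ (G.bijOn_in v).mapsTo he)
    have h5 := (hS _ _ h1).2.2 e e'' he h3 h4.symm
    have h6 := (hT _ _ h2).2.2 e'' e' h3 he' (h4.trans hc)
    exact ⟨h5.1.trans h6.1, _, h5.2, h6.2⟩

/-- The pairs of images under two morphisms form a bisimulation. -/
theorem Hom.isBisim_pair {G H : AdequateGraph p q} (φ ψ : Hom G H) :
    H.IsBisim (fun a b => ∃ x, φ.onV x = a ∧ ψ.onV x = b) := by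
  rintro _ _ ⟨x, rfl, rfl⟩
  refine ⟨by rw [φ.map_color, ψ.map_color], fun e e' he he' hc => ?_, fun e e' he he' hc => ?_⟩
  · obtain ⟨ε, rfl, rfl⟩ := φ.exists_out he
    obtain rfl : ψ.onE ε = e' := (H.bijOn_out _).injOn (ψ.map_s ε).symm he'
      (by rw [← hc, ψ.map_outColor, φ.map_outColor])
    exact ⟨by rw [φ.map_inColor, ψ.map_inColor], G.t ε, φ.map_t ε, ψ.map_t ε⟩
  · obtain ⟨ε, rfl, rfl⟩ := φ.exists_in he
    obtain rfl : ψ.onE ε = e' := (H.bijOn_in _).injOn (ψ.map_t ε).symm he'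
      (by rw [← hc, ψ.map_inColor, φ.map_inColor])
    exact ⟨by rw [φ.map_outColor, ψ.map_outColor], G.s ε, φ.map_s ε, ψ.map_s ε⟩

/-- The kernel of a morphism is a bisimulation. -/
theorem Hom.isBisim_ker {G H : AdequateGraph p q} (φ : Hom G H) :
    G.IsBisim (fun a b => φ.onV a = φ.onV b) := by
  intro v w h
  refine ⟨by rw [← φ.map_color, h, φ.map_color], fun e e' he he' hc => ?_,
    fun e e' he he' hc => ?_⟩
  · subst he he'
    have h1 : φ.onE e = φ.onE e' := (H.bijOn_out (φ.onV (G.s e))).injOn (φ.map_s e).symm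
      (by rw [h]; exact (φ.map_s e').symm) (by rw [φ.map_outColor, φ.map_outColor, hc])
    exact ⟨by rw [← φ.map_inColor, h1, φ.map_inColor], (φ.map_t e).trans ((congrArg H.t h1).trans (φ.map_t e').symm)⟩
  · subst he he'
    have h1 : φ.onE e = φ.onE e' := (H.bijOn_in (φ.onV (G.t e))).injOn (φ.map_t e).symm
      (by rw [h]; exact (φ.map_t e').symm) (by rw [φ.map_inColor, φ.map_inColor, hc])
    exact ⟨by rw [← φ.map_outColor, h1, φ.map_outColor], (φ.map_s e).trans ((congrArg H.s h1).trans (φ.map_s e').symm)⟩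

/-- The largest bisimulation. -/
def bisimSetoid (G : AdequateGraph p q) : Setoid G.V where
  r v w := ∃ S, G.IsBisim S ∧ S v w
  iseqv :=
    { refl := fun _ => ⟨_, IsBisim.eq G, rfl⟩
      symm := fun ⟨_, hS, h⟩ => ⟨_, hS.symm, h⟩
      trans := fun ⟨_, hS, h⟩ ⟨_, hT, h'⟩ => ⟨_, hS.comp hT, _, h, h'⟩ }

theorem bisimSetoid_isBisim (G : AdequateGraph p q) : G.IsBisim G.bisimSetoid := by
  rintro _ _ ⟨S, hS, h⟩
  exact ⟨(hS _ _ h).1,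
    fun e e' he he' hc => ((hS _ _ h).2.1 e e' he he' hc).imp id fun h' => ⟨S, hS, h'⟩,
    fun e e' he he' hc => ((hS _ _ h).2.2 e e' he he' hc).imp id fun h' => ⟨S, hS, h'⟩⟩

/-- Edges are equivalent if they start in bisimilar vertices and have the same output color. -/
def bisimSetoidE (G : AdequateGraph p q) : Setoid G.E where
  r e e' := G.bisimSetoid (G.s e) (G.s e') ∧ G.outColor e = G.outColor e'
  iseqv :=
    { refl := fun _ => ⟨G.bisimSetoid.refl _, rfl⟩
      symm := fun h => ⟨G.bisimSetoid.symm h.1, h.2.symm⟩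
      trans := fun h h' => ⟨G.bisimSetoid.trans h.1 h'.1, h.2.trans h'.2⟩ }

/-- The quotient of a graph by the largest bisimulation. -/
def minQuot (G : AdequateGraph p q) : AdequateGraph p q where
  V := Quotient G.bisimSetoid
  E := Quotient G.bisimSetoidE
  s := Quotient.map G.s fun _ _ h => h.1
  t := Quotient.map G.t fun e e' h => ((G.bisimSetoid_isBisim _ _ h.1).2.1 e e' rfl rfl h.2).2
  color := Quotient.lift G.color fun v w h => (G.bisimSetoid_isBisim v w h).1
  outColor := Quotient.lift G.outColor fun _ _ h => h.2
  inColor := Quotient.lift G.inColor fun e e' h =>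
    ((G.bisimSetoid_isBisim _ _ h.1).2.1 e e' rfl rfl h.2).1
  bijOn_out := by
    rintro ⟨v⟩
    refine ⟨?_, ?_, fun k hk => ?_⟩
    · rintro ⟨e⟩ he
      have he : G.bisimSetoid (G.s e) v := Quotient.exact he
      have := (G.bijOn_out (G.s e)).mapsTo (x := e) rfl
      rw [(G.bisimSetoid_isBisim _ _ he).1] at this
      exact this
    · rintro ⟨e⟩ he ⟨e'⟩ he' h
      have he : G.bisimSetoid (G.s e) v := Quotient.exact he
      have he' : G.bisimSetoid (G.s e') v := Quotient.exact he'
      exact Quotient.sound ⟨G.bisimSetoid.trans he (G.bisimSetoid.symm he'), h⟩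
    · obtain ⟨e, he, rfl⟩ := (G.bijOn_out v).surjOn hk
      exact ⟨Quotient.mk _ e, congrArg (Quotient.mk _) he, rfl⟩
  bijOn_in := by
    rintro ⟨v⟩
    refine ⟨?_, ?_, fun k hk => ?_⟩
    · rintro ⟨e⟩ he
      have he : G.bisimSetoid (G.t e) v := Quotient.exact he
      have := (G.bijOn_in (G.t e)).mapsTo (x := e) rfl
      rw [(G.bisimSetoid_isBisim _ _ he).1] at this
      exact this
    · rintro ⟨e⟩ he ⟨e'⟩ he' h
      have he : G.bisimSetoid (G.t e) v := Quotient.exact he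
      have he' : G.bisimSetoid (G.t e') v := Quotient.exact he'
      have := (G.bisimSetoid_isBisim _ _
        (G.bisimSetoid.trans he (G.bisimSetoid.symm he'))).2.2 e e' rfl rfl h
      exact Quotient.sound ⟨this.2, this.1⟩
    · obtain ⟨e, he, rfl⟩ := (G.bijOn_in v).surjOn hk
      exact ⟨Quotient.mk _ e, congrArg (Quotient.mk _) he, rfl⟩

/-- The projection to the minimal quotient. -/
def toMinQuot (G : AdequateGraph p q) : Hom G G.minQuot :=
  ⟨Quotient.mk _, Quotient.mk _, fun _ => rfl, fun _ => rfl, fun _ => rfl, fun _ => rfl,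
    fun _ => rfl⟩

theorem toMinQuot_surjective (G : AdequateGraph p q) : Function.Surjective G.toMinQuot.onV :=
  Quotient.mk_surjective

theorem minQuot_irreducible {G : AdequateGraph p q} (hf : Finite G.V ∧ Finite G.E)
    (hG : G.Connected) : G.minQuot.Irreducible := by
  have := hf.1
  have := hf.2
  have hc := G.toMinQuot.connected_of_surjective G.toMinQuot_surjective hG
  refine ⟨⟨inferInstanceAs (Finite (Quotient _)), inferInstanceAs (Finite (Quotient _))⟩, hc,
    fun H hH φ => ?_⟩
  have := hc.1
  refine φ.isIso_of_bijective ⟨?_, φ.surjective_onV hH⟩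
  rintro ⟨v⟩ ⟨w⟩ h
  exact Quotient.sound ⟨_, (φ.comp G.toMinQuot).isBisim_ker, h⟩

theorem Irreducible.eq_of_bisim {G : AdequateGraph p q} (hG : G.Irreducible)
    {S : G.V → G.V → Prop} (hS : G.IsBisim S) {v w : G.V} (h : S v w) : v = w := by
  have hc := G.toMinQuot.connected_of_surjective G.toMinQuot_surjective hG.2.1
  exact (hG.2.2 _ hc G.toMinQuot).1.1 (Quotient.sound ⟨S, hS, h⟩)

/-- Morphisms to an irreducible graph are unique. -/
theorem Irreducible.hom_eq {G H : AdequateGraph p q} (hH : H.Irreducible) (φ ψ : Hom G H) :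
    φ = ψ :=
  Hom.ext_onV (funext fun x => hH.eq_of_bisim (φ.isBisim_pair ψ) ⟨x, rfl, rfl⟩)

/-- An irreducible graph covered by a graph `G` is the minimal quotient of `G`. -/
theorem Irreducible.exists_iso_minQuot {G H : AdequateGraph p q} (hH : H.Irreducible)
    (hG : G.Connected) (φ : Hom G H) : ∃ ψ : Hom H G.minQuot, ψ.IsIso := by
  have := hG.1
  have hs := φ.surjective_onV hH.2.1
  have hsE := φ.surjective_onE hs
  have hc := G.toMinQuot.connected_of_surjective G.toMinQuot_surjective hG
  have hV : ∀ {v w}, φ.onV v = φ.onV w → G.toMinQuot.onV v = G.toMinQuot.onV w :=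
    fun h => Quotient.sound ⟨_, φ.isBisim_ker, h⟩
  have hE : ∀ {e e'}, φ.onE e = φ.onE e' → G.toMinQuot.onE e = G.toMinQuot.onE e' := fun {e e'} h =>
    Quotient.sound ⟨⟨_, φ.isBisim_ker, by rw [φ.map_s, φ.map_s, h]⟩,
      by rw [← φ.map_outColor, h, φ.map_outColor]⟩
  have h1 := Function.surjInv_eq hs
  have h2 := Function.surjInv_eq hsE
  let ψ : Hom H G.minQuot :=
    { onV := fun w => G.toMinQuot.onV (Function.surjInv hs w)
      onE := fun e => G.toMinQuot.onE (Function.surjInv hsE e)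
      map_s := fun e => by rw [← Hom.map_s]; exact hV (by rw [h1, φ.map_s, h2])
      map_t := fun e => by rw [← Hom.map_t]; exact hV (by rw [h1, φ.map_t, h2])
      map_color := fun w => by rw [Hom.map_color, ← φ.map_color, h1]
      map_outColor := fun e => by rw [Hom.map_outColor, ← φ.map_outColor, h2]
      map_inColor := fun e => by rw [Hom.map_inColor, ← φ.map_inColor, h2] }
  exact ⟨ψ, hH.2.2 _ hc ψ⟩

end Bisim

end AdequateGraph

namespace GraphClass

variable {r : ℕ} {p q : Fin r → ℕ}

theorem finite_restrict (G : FinGraph p q) (S : Set G.1.V)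
    (hS : ∀ e, G.1.s e ∈ S ↔ G.1.t e ∈ S) :
    Finite (G.1.restrict S hS).V ∧ Finite (G.1.restrict S hS).E := by
  have := G.2.1
  have := G.2.2
  exact ⟨inferInstanceAs (Finite S), inferInstanceAs (Finite {e // G.1.s e ∈ S})⟩

/-- The isomorphism class of the connected component of a vertex. -/
def compClass (G : FinGraph p q) (v : G.1.V) : GraphClass p q :=
  mk ⟨G.1.comp v, finite_restrict G _ _⟩

/-- Morphisms which are injective on vertices preserve the classes of components. -/
theorem compClass_map {G H : FinGraph p q} (φ : Hom G.1 H.1) (hφ : Function.Injective φ.onV)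
    (v : G.1.V) : compClass H (φ.onV v) = compClass G v :=
  (Quotient.sound (φ.exists_iso_comp hφ v)).symm

theorem compClass_of_connected {G : FinGraph p q} (hG : G.1.Connected) (v : G.1.V) :
    compClass G v = mk G :=
  Quotient.sound ⟨_, hG.compIncl_isIso v⟩

/-- The number of vertices whose connected component is in a given class. -/
def count (c : GraphClass p q) : GraphClass p q → ℕ :=
  Quotient.lift (fun G => Nat.card {v // compClass G v = c}) (by
    rintro G H ⟨φ, h⟩
    refine Nat.card_congr ((Equiv.ofBijective φ.onV h.1).subtypeEquiv fun v => ?_)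
    rw [Equiv.ofBijective_apply, compClass_map φ h.1.1])

theorem count_one (c : GraphClass p q) : count c 1 = 0 :=
  (Nat.card_eq_zero (α := {v // compClass _ v = c})).2 (Or.inl ⟨fun v => Empty.elim v.1⟩)

theorem count_mul (c a b : GraphClass p q) : count c (a * b) = count c a + count c b := by
  obtain ⟨G⟩ := a
  obtain ⟨H⟩ := b
  have := G.2.1
  have := H.2.1
  refine (Nat.card_congr (Equiv.subtypeSum (α := G.1.V) (β := H.1.V))).trans ?_
  refine Nat.card_sum.trans (congrArg₂ _ (Nat.card_congr (Equiv.subtypeEquivRight fun v => ?_))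
    (Nat.card_congr (Equiv.subtypeEquivRight fun v => ?_)))
  · exact Eq.congr_left (compClass_map (H := ⟨G.1.sum H.1, _⟩) (sumInl G.1 H.1) Sum.inl_injective v)
  · exact Eq.congr_left (compClass_map (H := ⟨G.1.sum H.1, _⟩) (sumInr G.1 H.1) Sum.inr_injective v)

variable (p q) in
/-- The classes of connected graphs. -/
def connected : Set (GraphClass p q) := {c | ∃ Γ : FinGraph p q, Γ.1.Connected ∧ mk Γ = c}

theorem compClass_mem (G : FinGraph p q) (v : G.1.V) : compClass G v ∈ connected p q :=
  ⟨_, G.1.comp_connected v, rfl⟩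

theorem count_self_ne {c : GraphClass p q} (hc : c ∈ connected p q) : count c c ≠ 0 := by
  obtain ⟨Γ, hΓ, rfl⟩ := hc
  have := Γ.2.1
  obtain ⟨v⟩ := hΓ.1
  refine Nat.card_ne_zero.2 ⟨⟨⟨v, compClass_of_connected hΓ v⟩⟩, inferInstance⟩

theorem count_of_ne {c d : GraphClass p q} (hd : d ∈ connected p q) (h : d ≠ c) :
    count c d = 0 := by
  obtain ⟨Γ, hΓ, rfl⟩ := hd
  refine Nat.card_eq_zero.2 (Or.inl ⟨fun v => h ?_⟩)
  rw [← v.2, compClass_of_connected hΓ]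

/-- Every graph is the disjoint union of its connected components. -/
theorem exists_prod_eq (G : FinGraph p q) : ∃ m : Multiset (GraphClass p q),
    (∀ c ∈ m, ∃ v, compClass G v = c) ∧ m.prod = mk G := by
  induction h : Nat.card G.1.V using Nat.strong_induction_on generalizing G with
  | _ n ih =>
    subst h
    have := G.2.1
    rcases isEmpty_or_nonempty G.1.V with hE | ⟨⟨v⟩⟩
    · refine ⟨0, by simp, Quotient.sound ⟨Hom.fromEmpty G.1, Hom.isIso_of_bijective _ ?_⟩⟩
      exact ⟨fun x => x.elim, fun x => isEmptyElim x⟩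
    · set S := G.1.compSet v
      have hSc := G.1.compSet_closed v
      let B : FinGraph p q := ⟨G.1.restrict Sᶜ fun e => not_congr (hSc e), finite_restrict G _ _⟩
      have hlt : Nat.card B.1.V < Nat.card G.1.V := by
        have := Finite.card_subtype_lt (α := G.1.V) (p := (· ∈ Sᶜ)) (x := v)
          (fun h => h (G.1.mem_compSet_self v))
        exact this
      obtain ⟨m, hm, hm'⟩ := ih _ hlt B rfl
      refine ⟨compClass G v ::ₘ m, fun c hc => ?_, ?_⟩
      · rcases Multiset.mem_cons.1 hc with rfl | hc
        · exact ⟨v, rfl⟩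
        · obtain ⟨w, rfl⟩ := hm c hc
          exact ⟨w.1, compClass_map (G := B)
            (G.1.restrictIncl Sᶜ fun e => not_congr (hSc e)) Subtype.val_injective w⟩
      · rw [Multiset.prod_cons, hm']
        exact Quotient.sound (G.1.exists_iso_sum_restrict S hSc)

theorem finsupp_prod_injective : Function.Injective
    fun s : connected p q →₀ ℕ => s.prod fun c k => (c : GraphClass p q) ^ k := by
  classical
  intro s t h
  have key : ∀ (u : connected p q →₀ ℕ) (c : connected p q),
      count c.1 (u.prod fun c k => (c : GraphClass p q) ^ k) = u c * count c.1 c.1 := by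
    intro u c
    have hpow : ∀ (d : GraphClass p q) (k : ℕ), count c.1 (d ^ k) = k * count c.1 d := by
      intro d k
      induction k with
      | zero => rw [pow_zero, count_one, zero_mul]
      | succ k ih => rw [pow_succ, count_mul, ih, Nat.succ_mul]
    induction u using Finsupp.induction with
    | zero => simp [count_one]
    | single_add a b f _ _ ih =>
      rw [Finsupp.prod_add_index' (fun _ => pow_zero _) (fun _ _ _ => pow_add _ _ _), count_mul, ih,
        Finsupp.prod_single_index (h := fun (c : connected p q) k => (c : GraphClass p q) ^ k)
          (pow_zero _), hpow, Finsupp.add_apply, add_mul,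
        Finsupp.single_apply]
      split_ifs with hac
      · rw [hac]
      · rw [count_of_ne a.2 (fun h => hac (Subtype.ext h))]; simp
  ext c
  have := congrArg (count c.1) h
  simp only [key] at this
  exact Nat.eq_of_mul_eq_mul_right (Nat.pos_of_ne_zero (count_self_ne c.2)) this

end GraphClass

namespace KX

variable (K : Type*) [Field K] {r : ℕ} (p q : Fin r → ℕ)

open GraphClass

theorem linearIndependent_of : LinearIndependent K (MonoidAlgebra.of K (GraphClass p q)) :=
  (MonoidAlgebra.basis (GraphClass p q) K).linearIndependent

theorem span_range_of :
    Submodule.span K (Set.range (MonoidAlgebra.of K (GraphClass p q))) = ⊤ :=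
  (MonoidAlgebra.basis (GraphClass p q) K).span_eq

/-- The connected diagrams are algebraically independent. -/
theorem algebraicIndependent_connected : AlgebraicIndependent K
    fun c : connected p q => MonoidAlgebra.of K (GraphClass p q) c := by
  refine LinearMap.injective_of_linearIndependent
    (f := (MvPolynomial.aeval fun c : connected p q =>
      MonoidAlgebra.of K (GraphClass p q) c).toLinearMap)
    (MvPolynomial.basisMonomials (connected p q) K).span_eq ?_
  rw [show _ ∘ _ = MonoidAlgebra.of K (GraphClass p q) ∘ _ from funext fun s => ?_]
  · exact (linearIndependent_of K p q).comp _ finsupp_prod_injective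
  · simp [MvPolynomial.aeval_monomial, Finsupp.prod]

theorem adjoin_connected : Algebra.adjoin K
    (MonoidAlgebra.of K (GraphClass p q) '' connected p q) = ⊤ := by
  refine Subalgebra.toSubmodule_injective (top_le_iff.1 ?_)
  rw [← span_range_of K p q, Submodule.span_le]
  rintro _ ⟨⟨G⟩, rfl⟩
  obtain ⟨m, hm, hm'⟩ := exists_prod_eq G
  change MonoidAlgebra.of K _ (mk G) ∈ Algebra.adjoin K _
  rw [← hm', map_multiset_prod]
  refine Subalgebra.multiset_prod_mem _ fun x hx => ?_
  obtain ⟨c, hc, rfl⟩ := Multiset.mem_map.1 hx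
  obtain ⟨v, rfl⟩ := hm c hc
  exact Algebra.subset_adjoin ⟨_, compClass_mem G v, rfl⟩

/-- Algebra homomorphisms out of `K[X]` can be prescribed on the connected diagrams. -/
theorem exists_algHom {T : Type*} [CommRing T] [Algebra K T] (g : connected p q → T) :
    ∃ F : KX K p q →ₐ[K] T, ∀ c : connected p q, F (MonoidAlgebra.of K _ c) = g c := by
  let e := AlgEquiv.ofBijective (MvPolynomial.aeval fun c : connected p q =>
    MonoidAlgebra.of K (GraphClass p q) (c : GraphClass p q))
    ⟨algebraicIndependent_connected K p q, by
      rw [← AlgHom.range_eq_top, ← Algebra.adjoin_range_eq_range_aeval, ← adjoin_connected K p q,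
        Set.image_eq_range]⟩
  refine ⟨(MvPolynomial.aeval g).comp e.symm.toAlgHom, fun c => ?_⟩
  have : e.symm (MonoidAlgebra.of K _ c) = MvPolynomial.X c := by
    rw [AlgEquiv.symm_apply_eq]
    exact (MvPolynomial.aeval_X (R := K)
      (fun c : connected p q => MonoidAlgebra.of K (GraphClass p q) c) c).symm
  change MvPolynomial.aeval g (e.symm (MonoidAlgebra.of K _ c)) = g c
  rw [this, MvPolynomial.aeval_X]

end KX

section Tensor

variable {K : Type*} [Field K] {S : Type*} [CommRing S] [Algebra K S] {ι : Type*}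
  (A : ι → Subalgebra K S)

theorem finite_update_ne_one_iff [DecidableEq ι] (a : ∀ i, A i) (i : ι) (x : A i) :
    {j | Function.update a i x j ≠ 1}.Finite ↔ {j | a j ≠ 1}.Finite := by
  constructor <;> refine fun h => (h.insert i).subset fun j hj => ?_ <;>
  · by_cases hji : j = i
    · exact Or.inl hji
    · right
      simpa [Function.update_of_ne hji] using hj

theorem finprod_update_eq_mul [DecidableEq ι] {a : ∀ i, A i} (ha : {j | a j ≠ 1}.Finite) (i : ι)
    (x : A i) : ∏ᶠ j, (Function.update a i x j : S) =
      x * ∏ᶠ j, (Function.update a i 1 j : S) := by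
  have h1 : ∏ᶠ j, (Function.update (1 : ∀ i, A i) i x j : S) = x := by
    rw [finprod_eq_single _ i fun j hj => by simp [Function.update_of_ne hj]]
    simp
  have hfin : ∀ {b : ∀ i, A i}, {j | b j ≠ 1}.Finite →
      (Function.mulSupport fun j => (b j : S)).Finite := fun {b} hb => hb.subset fun j hj h => by
    simp [h] at hj
  conv_rhs => rw [← h1]
  rw [← finprod_mul_distrib]
  · refine finprod_congr fun j => ?_
    by_cases hj : j = i
    · subst hj; simp
    · simp [Function.update_of_ne hj]
  · exact hfin ((finite_update_ne_one_iff A 1 i x).2 (by simp))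
  · exact hfin ((finite_update_ne_one_iff A a i 1).2 ha)

open Classical in
/-- The multilinear map which multiplies the entries of a family almost all of whose entries
are `1`, and vanishes on all other families. -/
def finprodMultilinear : MultilinearMap K (fun i => A i) S where
  toFun a := if {i | a i ≠ 1}.Finite then ∏ᶠ i, (a i : S) else 0
  map_update_add' a i x y := by
    simp only [finite_update_ne_one_iff]
    split_ifs with h
    · rw [finprod_update_eq_mul A h i (x + y), finprod_update_eq_mul A h i x,
        finprod_update_eq_mul A h i y, Subalgebra.coe_add, add_mul]
    · simp
  map_update_smul' a i k x := by
    simp only [finite_update_ne_one_iff]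
    split_ifs with h
    · rw [finprod_update_eq_mul A h i (k • x), finprod_update_eq_mul A h i x,
        Subalgebra.coe_smul, smul_mul_assoc]
    · simp

/-- If subalgebras generate the whole algebra and their inclusions into the tensor product extend
to a homomorphism on the whole algebra, then the algebra is the tensor product. -/
theorem algTensor_equiv_of_algHom [dec : DecidableEq ι] (F : S →ₐ[K] ⨂[K] i, A i)
    (hF : ∀ i (x : A i), F x = PiTensorProduct.singleAlgHom (R := K) (A := fun i => A i) i x)
    (hA : ⨆ i, A i = ⊤) :
    ∃ e : algTensor K (fun i => A i) ≃ₐ[K] S,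
      ∀ i (x : A i), e (algTensor.incl K (fun i => A i) i x) = x := by
  obtain rfl : dec = fun a b => Classical.propDecidable (a = b) := Subsingleton.elim _ _
  classical
  set Ψ : (⨂[K] i, A i) →ₗ[K] S := PiTensorProduct.lift (finprodMultilinear A) with hΨ
  have hΨt : ∀ a : ∀ i, A i, {j | a j ≠ 1}.Finite →
      Ψ (PiTensorProduct.tprod K a) = ∏ᶠ i, (a i : S) := fun a ha => by
    rw [hΨ, PiTensorProduct.lift.tprod]
    exact if_pos ha
  have hfin : ∀ {b : ∀ i, A i}, {j | b j ≠ 1}.Finite →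
      (Function.mulSupport fun j => (b j : S)).Finite := fun {b} hb => hb.subset fun j hj h => by
    simp [h] at hj
  have hmon : ∀ g ∈ Submonoid.closure (⋃ i, (A i : Set S)), ∃ a : ∀ i, A i,
      {j | a j ≠ 1}.Finite ∧ F g = PiTensorProduct.tprod K a ∧ ∏ᶠ i, (a i : S) = g := by
    intro g hg
    induction hg using Submonoid.closure_induction with
    | mem x hx =>
      obtain ⟨i, hx⟩ := Set.mem_iUnion.1 hx
      refine ⟨Function.update 1 i ⟨x, hx⟩, (finite_update_ne_one_iff A 1 i _).2 (by simp),
        hF i ⟨x, hx⟩, ?_⟩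
      rw [finprod_update_eq_mul A (by simp)]
      simp
    | one => exact ⟨1, by simp, by rw [map_one]; rfl, by simp⟩
    | mul x y _ _ hx hy =>
      obtain ⟨a, ha, hxa, rfl⟩ := hx
      obtain ⟨b, hb, hyb, rfl⟩ := hy
      refine ⟨a * b, (ha.union hb).subset fun j hj => ?_, ?_, ?_⟩
      · by_contra h
        simp only [Set.mem_union, Set.mem_ofPred_eq, not_or, not_not] at h
        exact hj (by rw [Pi.mul_apply, h.1, h.2, one_mul])
      · rw [map_mul, hxa, hyb, PiTensorProduct.tprod_mul_tprod]
      · exact finprod_mul_distrib (hfin ha) (hfin hb)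
  have hleft : ∀ x, Ψ (F x) = x := by
    intro x
    have hx : x ∈ Submodule.span K (Submonoid.closure (⋃ i, (A i : Set S)) : Set S) := by
      rw [← Algebra.adjoin_eq_span, Algebra.adjoin_iUnion]
      simp [Algebra.adjoin_eq, hA]
    induction hx using Submodule.span_induction with
    | mem g hg =>
      obtain ⟨a, ha, h1, h2⟩ := hmon g hg
      rw [h1, hΨt a ha, h2]
    | zero => simp
    | add x y _ _ hx hy => rw [map_add, map_add, hx, hy]
    | smul k x _ hx => rw [map_smul, map_smul, hx]
  have hrange : F.range = algTensor K (fun i => A i) := by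
    rw [← Algebra.map_top, ← hA, (Subalgebra.gc_map_comap F).l_iSup]
    refine iSup_congr fun i => ?_
    ext y
    constructor
    · rintro ⟨x, hx, rfl⟩
      exact ⟨⟨x, hx⟩, (hF i ⟨x, hx⟩).symm⟩
    · rintro ⟨x, rfl⟩
      exact ⟨x, x.2, hF i x⟩
  let e := (AlgEquiv.ofInjective F (Function.LeftInverse.injective hleft)).trans
    (Subalgebra.equivOfEq _ _ hrange)
  refine ⟨e.symm, fun i x => ?_⟩
  rw [AlgEquiv.symm_apply_eq]
  exact Subtype.ext (hF i x).symm

end Tensor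

namespace AdequateGraph.Hom

variable {r : ℕ} {p q : Fin r → ℕ} {G H L : AdequateGraph p q}

/-- The edges over a given edge correspond to the vertices over its source. -/
def fibreEquivSource (φ : Hom G H) (e : H.E) :
    {ε // φ.onE ε = e} ≃ {x // φ.onV x = H.s e} :=
  Equiv.ofBijective (fun ε => ⟨G.s ε.1, by rw [φ.map_s, ε.2]⟩)
    ⟨fun ε ε' h => Subtype.ext (φ.eq_of_s (congrArg Subtype.val h) (ε.2.trans ε'.2.symm)),
      fun x => by
        obtain ⟨ε, hε, h⟩ := φ.exists_out x.2.symm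
        exact ⟨⟨ε, h⟩, Subtype.ext hε⟩⟩

/-- The edges over a given edge correspond to the vertices over its target. -/
def fibreEquivTarget (φ : Hom G H) (e : H.E) :
    {ε // φ.onE ε = e} ≃ {x // φ.onV x = H.t e} :=
  Equiv.ofBijective (fun ε => ⟨G.t ε.1, by rw [φ.map_t, ε.2]⟩)
    ⟨fun ε ε' h => Subtype.ext (φ.eq_of_t (congrArg Subtype.val h) (ε.2.trans ε'.2.symm)),
      fun x => by
        obtain ⟨ε, hε, h⟩ := φ.exists_in x.2.symm
        exact ⟨⟨ε, h⟩, Subtype.ext hε⟩⟩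

theorem card_fibre_eq_of_isWalk (φ : Hom G H) {w : H.V} : ∀ {l : List (H.E × Bool)} {u : H.V},
    H.IsWalk u l w → Nat.card {x // φ.onV x = u} = Nat.card {x // φ.onV x = w}
  | [], _, h => by cases h; rfl
  | (e, true) :: l, _, h => by
    obtain ⟨rfl, h⟩ := h
    exact (Nat.card_congr ((φ.fibreEquivSource e).symm.trans (φ.fibreEquivTarget e))).trans
      (φ.card_fibre_eq_of_isWalk h)
  | (e, false) :: l, _, h => by
    obtain ⟨rfl, h⟩ := h
    exact (Nat.card_congr ((φ.fibreEquivTarget e).symm.trans (φ.fibreEquivSource e))).trans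
      (φ.card_fibre_eq_of_isWalk h)

theorem exists_isFold (φ : Hom G H) [Finite G.V] (hH : H.Connected) : ∃ n, φ.IsFold n := by
  obtain ⟨w⟩ := hH.1
  refine ⟨Nat.card {x // φ.onV x = w}, φ.isLocalIso, fun u => ⟨Set.toFinite _, ?_⟩⟩
  obtain ⟨l, hl⟩ := hH.2 u w
  exact φ.card_fibre_eq_of_isWalk hl

theorem IsFold.sumElim {φ : Hom G L} {ψ : Hom H L} {m n : ℕ} (hφ : φ.IsFold m)
    (hψ : ψ.IsFold n) : (φ.sumElim ψ).IsFold (m + n) := by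
  refine ⟨isLocalIso _, fun w => ?_⟩
  have h : {v | (φ.sumElim ψ).onV v = w} =
      Sum.inl '' {v | φ.onV v = w} ∪ Sum.inr '' {v | ψ.onV v = w} := by
    ext (v | v)
    · exact ⟨fun h => Or.inl ⟨v, h, rfl⟩, by rintro (⟨x, hx, h⟩ | ⟨x, hx, h⟩) <;> cases h; exact hx⟩
    · exact ⟨fun h => Or.inr ⟨v, h, rfl⟩, by rintro (⟨x, hx, h⟩ | ⟨x, hx, h⟩) <;> cases h; exact hx⟩
  have h1 := ((hφ.2 w).1.image (Sum.inl : G.V → G.V ⊕ H.V))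
  have h2 := ((hψ.2 w).1.image (Sum.inr : H.V → G.V ⊕ H.V))
  rw [h]
  refine ⟨h1.union h2, (Set.ncard_union_eq ?_ h1 h2).trans ?_⟩
  swap
  · rw [ Set.ncard_image_of_injective _ Sum.inl_injective,
      Set.ncard_image_of_injective _ Sum.inr_injective, (hφ.2 w).2, (hψ.2 w).2]
  rw [Set.disjoint_left]
  rintro _ ⟨x, -, rfl⟩ ⟨y, -, h⟩
  cases h

theorem isFold_fromEmpty (L : AdequateGraph p q) : (fromEmpty L).IsFold 0 := by
  refine ⟨isLocalIso _, fun w => ?_⟩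
  have h : {v | (fromEmpty L).onV v = w} = ∅ := Set.eq_empty_of_forall_notMem fun v => v.elim
  rw [h]
  simp

theorem IsFold.comp_iso {φ : Hom H L} {n : ℕ} (hφ : φ.IsFold n) {α : Hom G H} (hα : α.IsIso) :
    (φ.comp α).IsFold n := by
  refine ⟨isLocalIso _, fun w => ?_⟩
  have h : {v | (φ.comp α).onV v = w} = (Equiv.ofBijective α.onV hα.1).symm '' {v | φ.onV v = w} := by
    rw [Equiv.image_eq_preimage_symm]; rfl
  rw [h, Set.ncard_image_of_injective _ (Equiv.injective _)]
  exact ⟨(hφ.2 w).1.image _, (hφ.2 w).2⟩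

theorem IsFold.iso_comp {φ : Hom G H} {n : ℕ} (hφ : φ.IsFold n) {α : Hom H L} (hα : α.IsIso) :
    (α.comp φ).IsFold n := by
  refine ⟨isLocalIso _, fun w => ?_⟩
  obtain ⟨u, rfl⟩ := hα.1.2 w
  have h : {v | (α.comp φ).onV v = α.onV u} = {v | φ.onV v = u} := Set.ext fun v => hα.1.1.eq_iff
  rw [h]
  exact hφ.2 u

theorem IsFold.unique {φ : Hom G H} {m n : ℕ} (hm : φ.IsFold m) (hn : φ.IsFold n)
    (w : H.V) : m = n :=
  (hm.2 w).2.symm.trans (hn.2 w).2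

theorem IsFold.ncard_color {φ : Hom G H} {n : ℕ} (hφ : φ.IsFold n) [Finite G.V] [Finite H.V]
    (a : Fin r) : {v | G.color v = a}.ncard = n * {w | H.color w = a}.ncard := by
  classical
  have := Fintype.ofFinite G.V
  have := Fintype.ofFinite H.V
  rw [Set.ncard_eq_toFinset_card', Set.ncard_eq_toFinset_card',
    Finset.card_eq_sum_card_fiberwise (f := φ.onV) (t := {w | H.color w = a}.toFinset)]
  · rw [mul_comm, ← smul_eq_mul, ← Finset.sum_const]
    refine Finset.sum_congr rfl fun w hw => ?_
    rw [← (hφ.2 w).2, Set.ncard_eq_toFinset_card']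
    congr 1
    ext v
    have hw : H.color w = a := by simpa using hw
    simp only [Finset.mem_filter, Set.mem_toFinset, Set.mem_ofPred_eq, and_iff_right_iff_imp]
    rintro rfl
    rw [← φ.map_color, hw]
  · intro v hv
    simpa [φ.map_color] using hv

end AdequateGraph.Hom

namespace GraphClass

variable {r : ℕ} {p q : Fin r → ℕ}

theorem exists_mem_connectedCovers {c : GraphClass p q} (hc : c ∈ connected p q) :
    ∃ c₀ : IrrClass p q, c ∈ c₀.1.connectedCovers := by
  obtain ⟨Γ, hΓ, rfl⟩ := hc
  have h := minQuot_irreducible Γ.2 hΓ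
  have := hΓ.1
  exact ⟨⟨mk ⟨Γ.1.minQuot, h.1⟩, _, h, rfl⟩, Γ, _, rfl, rfl, hΓ, Γ.1.toMinQuot,
    Γ.1.toMinQuot.isCovering h.2.1⟩

theorem connectedCovers_subset (c₀ : GraphClass p q) : c₀.connectedCovers ⊆ connected p q :=
  fun _ ⟨Γ, _, h, _, hΓ, _⟩ => ⟨Γ, hΓ, h⟩

theorem irreducible_of_mk_eq {Γ Γ' : FinGraph p q} (h : Γ.1.Irreducible) (he : mk Γ = mk Γ') :
    Γ'.1.Irreducible := by
  obtain ⟨φ, hφ⟩ := Quotient.exact he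
  refine ⟨Γ'.2, φ.connected_of_surjective hφ.1.2 h.2.1, fun H hH ψ => ?_⟩
  have h1 := (h.2.2 H hH (ψ.comp φ)).1
  exact ψ.isIso_of_bijective ((Function.Bijective.of_comp_iff _ hφ.1).1 h1)

theorem eq_of_mem_connectedCovers {c : GraphClass p q} {c₀ c₁ : IrrClass p q}
    (h₀ : c ∈ c₀.1.connectedCovers) (h₁ : c ∈ c₁.1.connectedCovers) : c₀ = c₁ := by
  suffices key : ∀ {Γ : FinGraph p q} {c₀ : IrrClass p q}, mk Γ ∈ c₀.1.connectedCovers →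
      ∃ hf, c₀.1 = mk ⟨Γ.1.minQuot, hf⟩ by
    obtain ⟨Γ, rfl⟩ := Quotient.exists_rep c
    obtain ⟨_, h⟩ := key h₀
    obtain ⟨_, h'⟩ := key h₁
    exact Subtype.ext (h.trans h'.symm)
  rintro Γ ⟨_, Γ₀, hΓ₀, rfl⟩ ⟨Γ', Γ₀', h, h', hΓ', φ, -⟩
  obtain ⟨α, hα⟩ := Quotient.exact h
  have hΓ := α.connected_of_surjective hα.1.2 hΓ'
  obtain ⟨ψ, hψ⟩ := (irreducible_of_mk_eq hΓ₀ h'.symm).exists_iso_minQuot hΓ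
    (φ.comp (α.inv hα))
  exact ⟨(minQuot_irreducible Γ.2 hΓ).1, h'.symm.trans (Quotient.sound ⟨ψ, hψ⟩)⟩

/-- All components of a graph over a connected graph cover it. -/
theorem compClass_mem_connectedCovers {Γ Γ₀ : FinGraph p q} (hΓ₀ : Γ₀.1.Connected)
    (φ : Hom Γ.1 Γ₀.1) (v : Γ.1.V) : compClass Γ v ∈ (mk Γ₀).connectedCovers := by
  have hc := Γ.1.comp_connected v
  have := hc.1
  exact ⟨⟨Γ.1.comp v, _⟩, Γ₀, rfl, rfl, hc, φ.comp (Γ.1.compIncl v), Hom.isCovering _ hΓ₀⟩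

/-- The graph classes over `Γ₀`. -/
def diagramsOver (Γ₀ : FinGraph p q) : Submonoid (GraphClass p q) where
  carrier := {g | ∃ Γ, mk Γ = g ∧ Nonempty (Hom Γ.1 Γ₀.1)}
  one_mem' := ⟨_, rfl, ⟨Hom.fromEmpty _⟩⟩
  mul_mem' := by
    rintro _ _ ⟨Γ, rfl, ⟨φ⟩⟩ ⟨Γ', rfl, ⟨ψ⟩⟩
    exact ⟨_, rfl, ⟨φ.sumElim ψ⟩⟩

theorem closure_connectedCovers {Γ₀ : FinGraph p q} (hΓ₀ : Γ₀.1.Connected) :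
    Submonoid.closure (mk Γ₀).connectedCovers = diagramsOver Γ₀ := by
  refine le_antisymm (Submonoid.closure_le.2 ?_) ?_
  · rintro _ ⟨Γ, Γ₀', rfl, h, -, φ, -⟩
    obtain ⟨α, hα⟩ := Quotient.exact h
    exact ⟨Γ, rfl, ⟨α.comp φ⟩⟩
  · rintro _ ⟨Γ, rfl, ⟨φ⟩⟩
    obtain ⟨m, hm, hm'⟩ := exists_prod_eq Γ
    rw [← hm']
    refine Submonoid.multiset_prod_mem _ _ fun c hc => Submonoid.subset_closure ?_
    obtain ⟨v, rfl⟩ := hm c hc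
    exact compClass_mem_connectedCovers hΓ₀ φ v

theorem exists_degree {Γ₀ : FinGraph p q} (hΓ₀ : Γ₀.1.Connected) (g : diagramsOver Γ₀) :
    ∃ n, ∃ Γ, mk Γ = g.1 ∧ ∃ φ : Hom Γ.1 Γ₀.1, φ.IsFold n := by
  obtain ⟨_, Γ, rfl, ⟨φ⟩⟩ := g
  have := Γ.2.1
  obtain ⟨n, hn⟩ := φ.exists_isFold hΓ₀
  exact ⟨n, Γ, rfl, φ, hn⟩

/-- The number of sheets of a graph over `Γ₀`. -/
def degree {Γ₀ : FinGraph p q} (hΓ₀ : Γ₀.1.Connected) (g : diagramsOver Γ₀) : ℕ :=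
  (exists_degree hΓ₀ g).choose

theorem degree_eq_iff {Γ₀ : FinGraph p q} (hΓ₀ : Γ₀.1.Irreducible) (g : diagramsOver Γ₀) (n : ℕ) :
    degree hΓ₀.2.1 g = n ↔ ∃ Γ, mk Γ = g.1 ∧ ∃ φ : Hom Γ.1 Γ₀.1, φ.IsFold n := by
  have h := (exists_degree hΓ₀.2.1 g).choose_spec
  refine ⟨fun h' => h' ▸ h, ?_⟩
  rintro ⟨Γ, hΓ, φ, hφ⟩
  obtain ⟨Γ', hΓ', φ', hφ'⟩ := h
  obtain ⟨α, hα⟩ := Quotient.exact (hΓ.trans hΓ'.symm)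
  obtain ⟨w⟩ := hΓ₀.2.1.1
  rw [hΓ₀.hom_eq φ (φ'.comp α)] at hφ
  exact (hφ'.comp_iso hα).unique hφ w

theorem exists_isFold_iff {Γ Γ₀ : FinGraph p q} {n : ℕ} :
    (∃ Γ₀', mk Γ₀' = mk Γ₀ ∧ ∃ φ : Hom Γ.1 Γ₀'.1, φ.IsFold n) ↔
      ∃ φ : Hom Γ.1 Γ₀.1, φ.IsFold n := by
  refine ⟨fun ⟨Γ₀', h, φ, hφ⟩ => ?_, fun h => ⟨Γ₀, rfl, h⟩⟩
  obtain ⟨α, hα⟩ := Quotient.exact h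
  exact ⟨α.comp φ, hφ.iso_comp hα⟩

end GraphClass

theorem isInternal_span_image {K M ι κ : Type*} [Field K] [AddCommGroup M] [Module K M]
    [DecidableEq κ] {b : ι → M} (hb : LinearIndependent K b)
    (hs : Submodule.span K (Set.range b) = ⊤) (d : ι → κ) :
    DirectSum.IsInternal fun k => Submodule.span K (b '' (d ⁻¹' {k})) := by
  refine DirectSum.isInternal_submodule_of_iSupIndep_of_iSup_eq_top (fun k => ?_) ?_
  · have hle : ⨆ j, ⨆ (_ : j ≠ k), Submodule.span K (b '' (d ⁻¹' {j})) ≤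
        Submodule.span K (b '' (d ⁻¹' {k}ᶜ)) :=
      iSup₂_le fun j hj => Submodule.span_mono (Set.image_mono
        (Set.preimage_mono (by simpa using hj.symm)))
    exact (hb.disjoint_span_image (disjoint_compl_right.preimage d)).mono_right hle
  · rw [← Submodule.span_iUnion, ← Set.image_iUnion, ← Set.preimage_iUnion, Set.iUnion_of_singleton,
      Set.preimage_univ, Set.image_univ, hs]

namespace KX

variable (K : Type*) [Field K] {r : ℕ} {p q : Fin r → ℕ}

open GraphClass

theorem of_mem_piece {Γ₀ : FinGraph p q} (hΓ₀ : Γ₀.1.Connected) {g : GraphClass p q}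
    (hg : g ∈ diagramsOver Γ₀) : MonoidAlgebra.of K _ g ∈ piece K (mk Γ₀) := by
  rw [← closure_connectedCovers hΓ₀] at hg
  induction hg using Submonoid.closure_induction with
  | mem x hx => exact Algebra.subset_adjoin ⟨x, hx, rfl⟩
  | one => rw [map_one]; exact one_mem _
  | mul x y _ _ hx hy => rw [map_mul]; exact mul_mem hx hy

/-- The basis of `K[X]_{Γ₀}` of all graphs over `Γ₀`. -/
def ofOver {Γ₀ : FinGraph p q} (hΓ₀ : Γ₀.1.Connected) (g : diagramsOver Γ₀) : piece K (mk Γ₀) :=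
  ⟨MonoidAlgebra.of K _ g.1, of_mem_piece K hΓ₀ g.2⟩

theorem linearIndependent_ofOver {Γ₀ : FinGraph p q} (hΓ₀ : Γ₀.1.Connected) :
    LinearIndependent K (ofOver K hΓ₀) :=
  LinearIndependent.of_comp (piece K (mk Γ₀)).val.toLinearMap
    ((linearIndependent_of K p q).comp _ Subtype.val_injective)

theorem span_range_ofOver {Γ₀ : FinGraph p q} (hΓ₀ : Γ₀.1.Connected) :
    Submodule.span K (Set.range (ofOver K hΓ₀)) = ⊤ := by
  refine Submodule.map_injective_of_injective
    (f := (piece K (mk Γ₀)).val.toLinearMap) Subtype.val_injective ?_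
  rw [Submodule.map_span, Submodule.map_top, ← Set.range_comp]
  have h : Set.range ((piece K (mk Γ₀)).val.toLinearMap ∘ ofOver K hΓ₀) =
      (Submonoid.closure (MonoidAlgebra.of K (GraphClass p q) '' (mk Γ₀).connectedCovers) :
        Set (KX K p q)) := by
    rw [← MonoidHom.map_mclosure, closure_connectedCovers hΓ₀]
    ext x
    exact ⟨fun ⟨g, hg⟩ => ⟨g.1, g.2, hg⟩, fun ⟨g, hg, hx⟩ => ⟨⟨g, hg⟩, hx⟩⟩
  rw [h, ← Algebra.adjoin_eq_span]
  ext x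
  exact ⟨fun hx => ⟨⟨x, hx⟩, rfl⟩, fun ⟨y, hy⟩ => hy ▸ y.2⟩

theorem gradedPiece_eq_span {Γ₀ : FinGraph p q} (hΓ₀ : Γ₀.1.Irreducible) (n : ℕ) :
    gradedPiece K (mk Γ₀) n =
      Submodule.span K (ofOver K hΓ₀.2.1 '' (degree hΓ₀.2.1 ⁻¹' {n})) := by
  rw [gradedPiece]
  congr 1
  ext x
  constructor
  · rintro ⟨Γ, Γ₀', h, hφ, hx⟩
    obtain ⟨φ, hφ⟩ := exists_isFold_iff.1 ⟨Γ₀', h, hφ⟩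
    refine ⟨⟨mk Γ, Γ, rfl, ⟨φ⟩⟩, (degree_eq_iff hΓ₀ _ n).2 ⟨Γ, rfl, φ, hφ⟩, Subtype.ext hx.symm⟩
  · rintro ⟨g, hg, rfl⟩
    obtain ⟨Γ, hΓ, h⟩ := (degree_eq_iff hΓ₀ _ n).1 hg
    exact ⟨Γ, Γ₀, rfl, h, by rw [diag, hΓ]; rfl⟩

theorem gradedPiece_isInternal {Γ₀ : FinGraph p q} (hΓ₀ : Γ₀.1.Irreducible) :
    DirectSum.IsInternal (gradedPiece K (mk Γ₀)) := by
  rw [funext (gradedPiece_eq_span K hΓ₀)]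
  exact isInternal_span_image (linearIndependent_ofOver K _) (span_range_ofOver K _) _

theorem gradedPiece_gradedMonoid (c₀ : GraphClass p q) :
    SetLike.GradedMonoid (gradedPiece K c₀) where
  one_mem := by
    obtain ⟨Γ₀, rfl⟩ := Quotient.exists_rep c₀
    exact Submodule.subset_span ⟨_, Γ₀, rfl, ⟨_, Hom.isFold_fromEmpty Γ₀.1⟩,
      (map_one (MonoidAlgebra.of K (GraphClass p q))).symm⟩
  mul_mem := by
    intro i j a b ha hb
    refine Submodule.mul_le.1 (?_ : gradedPiece K c₀ i * gradedPiece K c₀ j ≤ _) a ha b hb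
    rw [gradedPiece, gradedPiece, Submodule.span_mul_span, Submodule.span_le]
    rintro _ ⟨x, ⟨Γ, Γ₀, rfl, ⟨φ, hφ⟩, hx⟩, y, ⟨Γ', Γ₀', h, hψ, hy⟩, rfl⟩
    obtain ⟨ψ, hψ⟩ := exists_isFold_iff.1 ⟨Γ₀', h, hψ⟩
    refine Submodule.subset_span ⟨⟨Γ.1.sum Γ'.1, ?_⟩, Γ₀, rfl, ⟨_, hφ.sumElim hψ⟩, ?_⟩
    · have := Γ.2.1
      have := Γ.2.2
      have := Γ'.2.1
      have := Γ'.2.2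
      exact ⟨inferInstanceAs (Finite (Γ.1.V ⊕ Γ'.1.V)), inferInstanceAs (Finite (Γ.1.E ⊕ Γ'.1.E))⟩
    simp only [MulMemClass.coe_mul, hx, hy]
    exact (map_mul (MonoidAlgebra.of K (GraphClass p q)) (mk Γ) (mk Γ')).symm

theorem gradedPiece_homogeneous (Γ₀ : FinGraph p q) (n : ℕ) (x : piece K (mk Γ₀))
    (hx : x ∈ gradedPiece K (mk Γ₀) n) :
    (x : KX K p q) ∈ homogeneous K p q fun a => n * {w | Γ₀.1.color w = a}.ncard := by
  suffices gradedPiece K (mk Γ₀) n ≤ (homogeneous K p q fun a =>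
      n * {w | Γ₀.1.color w = a}.ncard).comap (piece K (mk Γ₀)).val.toLinearMap from this hx
  refine Submodule.span_le.2 ?_
  rintro x ⟨Γ, Γ₀', h, hφ, hx⟩
  obtain ⟨φ, hφ⟩ := exists_isFold_iff.1 ⟨Γ₀', h, hφ⟩
  have := Γ.2.1
  have := Γ₀.2.1
  exact Submodule.subset_span ⟨Γ, hφ.ncard_color, hx.symm⟩

theorem iSup_piece : ⨆ c : IrrClass p q, piece K c.1 = ⊤ := by
  rw [← top_le_iff, ← adjoin_connected K p q]
  refine Algebra.adjoin_le ?_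
  rintro _ ⟨c, hc, rfl⟩
  obtain ⟨c₀, h⟩ := exists_mem_connectedCovers hc
  exact le_iSup (fun c : IrrClass p q => piece K c.1) c₀ (Algebra.subset_adjoin ⟨c, h, rfl⟩)

theorem exists_algTensor_equiv :
    ∃ e : algTensor K (fun c : IrrClass p q => piece K c.1) ≃ₐ[K] KX K p q,
      ∀ (c : IrrClass p q) (x : piece K c.1),
        e (algTensor.incl K (fun c : IrrClass p q => piece K c.1) c x) = x := by
  classical
  choose irr hirr using fun c : connected p q => exists_mem_connectedCovers c.2
  obtain ⟨F, hF⟩ := exists_algHom K p q fun c : connected p q =>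
    PiTensorProduct.singleAlgHom (R := K) (A := fun c : IrrClass p q => piece K c.1) (irr c)
      ⟨MonoidAlgebra.of K _ c.1, Algebra.subset_adjoin ⟨c.1, hirr c, rfl⟩⟩
  refine algTensor_equiv_of_algHom (fun c : IrrClass p q => piece K c.1) F (fun c₀ x => ?_)
    (iSup_piece K)
  suffices F.comp (piece K c₀.1).val = PiTensorProduct.singleAlgHom (R := K)
      (A := fun c : IrrClass p q => piece K c.1) c₀ by
    rw [← AlgHom.congr_fun this x]; rfl
  refine AlgHom.adjoin_ext ?_
  rintro _ ⟨c, hc, rfl⟩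
  refine (hF ⟨c, connectedCovers_subset _ hc⟩).trans ?_
  have key : ∀ (c₁ : IrrClass p q) (h : c ∈ c₁.1.connectedCovers), c₁ = c₀ →
      PiTensorProduct.singleAlgHom (R := K) (A := fun c : IrrClass p q => piece K c.1) c₁
        ⟨MonoidAlgebra.of K _ c, Algebra.subset_adjoin ⟨c, h, rfl⟩⟩ =
      PiTensorProduct.singleAlgHom (R := K) (A := fun c : IrrClass p q => piece K c.1) c₀
        ⟨MonoidAlgebra.of K _ c, Algebra.subset_adjoin ⟨c, hc, rfl⟩⟩ := by
    rintro _ _ rfl; rfl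
  exact key _ (hirr _) (eq_of_mem_connectedCovers (hirr _) hc)

theorem algebraicIndependent_connectedCovers (c₀ : GraphClass p q) :
    AlgebraicIndependent K fun c : c₀.connectedCovers => MonoidAlgebra.of K (GraphClass p q) c :=
  (algebraicIndependent_connected K p q).comp
    (Set.inclusion (connectedCovers_subset c₀)) (Set.inclusion_injective _)

end KX

namespace FreeGroup

theorem mk_cons_true {α : Type*} (e : α) (l : List (α × Bool)) :
    mk ((e, true) :: l) = of e * mk l := rfl

theorem mk_cons_false {α : Type*} (e : α) (l : List (α × Bool)) :
    mk ((e, false) :: l) = (of e)⁻¹ * mk l := rfl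

/-- A set which generates a finitely generated free group freely is finite. -/
theorem finite_of_surjective {α β : Type*} [Finite α] (f : FreeGroup α →* FreeGroup β)
    (hf : Function.Surjective f) : Finite β := by
  classical
  have h1 : Function.Injective fun (g : β → Multiplicative (ZMod 2)) (a : α) =>
      lift g (f (of a)) := by
    intro g g' h
    have h2 : (lift g).comp f = (lift g').comp f := FreeGroup.ext_hom _ _ fun a => congrFun h a
    ext1 b
    obtain ⟨x, hx⟩ := hf (of b)
    have h3 := DFunLike.congr_fun h2 x
    simpa [hx] using h3
  have h4 := Finite.of_injective _ h1
  refine Finite.of_injective (fun b : β => (Pi.mulSingle b (Multiplicative.ofAdd 1) :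
    β → Multiplicative (ZMod 2))) fun b b' h => ?_
  by_contra hne
  have h5 := congrFun h b
  simp only [Pi.mulSingle_eq_same, Pi.mulSingle_eq_of_ne hne] at h5
  exact absurd h5 (by decide)

end FreeGroup

namespace AdequateGraph

variable {r : ℕ} {p q : Fin r → ℕ}

section FundGroup

variable {G : AdequateGraph p q}

/-- A choice of walks from `v` to all other vertices; the walk from `v` to `v` is trivial. -/
structure WalkSystem (G : AdequateGraph p q) (v : G.V) where
  walk : G.V → List (G.E × Bool)
  isWalk : ∀ w, G.IsWalk v (walk w) w
  walk_base : walk v = []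

theorem Connected.nonempty_walkSystem (hG : G.Connected) (v : G.V) :
    Nonempty (WalkSystem G v) := by
  classical
  choose W hW using hG.2 v
  refine ⟨⟨Function.update W v [], fun w => ?_, by simp⟩⟩
  by_cases h : w = v
  · subst h; simp only [Function.update_self]; rfl
  · simpa [Function.update_of_ne h] using hW w

namespace WalkSystem

variable {v : G.V} (W : WalkSystem G v)

/-- The homotopy class of the chosen walk to a vertex. -/
def path (w : G.V) : FreeGroup G.E := FreeGroup.mk (W.walk w)

theorem path_base : W.path v = 1 := by rw [path, W.walk_base]; rfl

/-- The closed walk along an edge. -/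
def loop (e : G.E) : G.fundGroup v :=
  ⟨W.path (G.s e) * FreeGroup.of e * (W.path (G.t e))⁻¹,
    W.walk (G.s e) ++ [(e, true)] ++ FreeGroup.invRev (W.walk (G.t e)),
    ((W.isWalk _).append (l' := [(e, true)]) ⟨rfl, rfl⟩).append (W.isWalk _).invRev, by
      rw [← FreeGroup.mul_mk, ← FreeGroup.mul_mk, ← FreeGroup.inv_mk]; rfl⟩

/-- The retraction of the free group on the edges to the fundamental group. -/
def retraction : FreeGroup G.E →* G.fundGroup v := FreeGroup.lift W.loop

theorem retraction_of (e : G.E) : W.retraction (FreeGroup.of e) = W.loop e :=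
  FreeGroup.lift_apply_of

theorem retraction_mk {w : G.V} : ∀ {l : List (G.E × Bool)} {u : G.V}, G.IsWalk u l w →
    (W.retraction (FreeGroup.mk l) : FreeGroup G.E) =
      W.path u * FreeGroup.mk l * (W.path w)⁻¹
  | [], _, h => by
    cases h
    rw [← FreeGroup.one_eq_mk, map_one, mul_one, mul_inv_cancel]; rfl
  | (e, true) :: l, _, h => by
    obtain ⟨rfl, h⟩ := h
    rw [FreeGroup.mk_cons_true, map_mul, retraction_of, Subgroup.coe_mul, retraction_mk h, loop]
    group
  | (e, false) :: l, _, h => by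
    obtain ⟨rfl, h⟩ := h
    rw [FreeGroup.mk_cons_false, map_mul, map_inv, retraction_of, Subgroup.coe_mul,
      Subgroup.coe_inv, retraction_mk h, loop]
    group

theorem retraction_coe (x : G.fundGroup v) : W.retraction x = x := by
  obtain ⟨_, l, hl, rfl⟩ := x
  refine Subtype.ext ?_
  rw [W.retraction_mk hl, W.path_base]
  simp

end WalkSystem

theorem Connected.exists_fundGroup_equiv [Finite G.E] (hG : G.Connected) (v : G.V) :
    ∃ m : ℕ, Nonempty (FreeGroup (Fin m) ≃* G.fundGroup v) := by
  obtain ⟨W⟩ := hG.nonempty_walkSystem v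
  let e := IsFreeGroup.toFreeGroup (G.fundGroup v)
  have hs : Function.Surjective (e.toMonoidHom.comp W.retraction) :=
    e.surjective.comp fun x => ⟨x, W.retraction_coe x⟩
  have := FreeGroup.finite_of_surjective _ hs
  obtain ⟨m, ⟨f⟩⟩ := Finite.exists_equiv_fin (IsFreeGroup.Generators (G.fundGroup v))
  exact ⟨m, ⟨(FreeGroup.freeGroupCongr f.symm).trans e.symm⟩⟩

end FundGroup

namespace Hom

variable {G H : AdequateGraph p q}

/-- Homotopy classes of walks act on the vertices of a finite covering: the action of an edge takes
the target of any of its lifts to the source. -/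
theorem exists_monodromy (φ : Hom G H) [Finite G.V] : ∃ ρ : FreeGroup H.E →* Equiv.Perm G.V,
    ∀ ε, ρ (FreeGroup.of (φ.onE ε)) (G.t ε) = G.s ε := by
  classical
  have := Fintype.ofFinite G.V
  let P (e : H.E) : {x // φ.onV x = H.t e} ≃ {x // φ.onV x = H.s e} :=
    (φ.fibreEquivTarget e).symm.trans (φ.fibreEquivSource e)
  refine ⟨FreeGroup.lift fun e => (P e).extendSubtype, fun ε => ?_⟩
  rw [FreeGroup.lift_apply_of]
  refine ((P (φ.onE ε)).extendSubtype_apply_of_mem (G.t ε) (φ.map_t ε)).trans ?_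
  have h : (φ.fibreEquivTarget (φ.onE ε)).symm ⟨G.t ε, φ.map_t ε⟩ = ⟨ε, rfl⟩ := by
    rw [Equiv.symm_apply_eq]; rfl
  simp only [P, Equiv.trans_apply, h]
  rfl

/-- The monodromy action on the vertices of a finite covering. -/
def monodromy (φ : Hom G H) [Finite G.V] : FreeGroup H.E →* Equiv.Perm G.V :=
  φ.exists_monodromy.choose

theorem monodromy_of (φ : Hom G H) [Finite G.V] (ε : G.E) :
    φ.monodromy (FreeGroup.of (φ.onE ε)) (G.t ε) = G.s ε :=
  φ.exists_monodromy.choose_spec ε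

theorem monodromy_mk (φ : Hom G H) [Finite G.V] {w : G.V} :
    ∀ {l : List (G.E × Bool)} {u : G.V}, G.IsWalk u l w →
      φ.monodromy (FreeGroup.map φ.onE (FreeGroup.mk l)) w = u
  | [], _, h => by
    cases h
    rw [← FreeGroup.one_eq_mk, map_one, map_one]; rfl
  | (e, true) :: l, _, h => by
    obtain ⟨rfl, h⟩ := h
    rw [FreeGroup.mk_cons_true, map_mul, map_mul, FreeGroup.map.of, Equiv.Perm.mul_apply,
      monodromy_mk φ h, monodromy_of]
  | (e, false) :: l, _, h => by
    obtain ⟨rfl, h⟩ := h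
    rw [FreeGroup.mk_cons_false, map_mul, map_mul, map_inv, map_inv, FreeGroup.map.of,
      Equiv.Perm.mul_apply, monodromy_mk φ h, Equiv.Perm.inv_eq_iff_eq, monodromy_of]

/-- The lift of a walk ends where the monodromy says. -/
theorem exists_lift_monodromy (φ : Hom G H) [Finite G.V] {x : G.V} {l : List (H.E × Bool)}
    {w : H.V} (h : H.IsWalk (φ.onV x) l w) :
    ∃ l', G.IsWalk x l' (φ.monodromy (FreeGroup.mk l)⁻¹ x) ∧
      FreeGroup.map φ.onE (FreeGroup.mk l') = FreeGroup.mk l ∧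
      φ.onV (φ.monodromy (FreeGroup.mk l)⁻¹ x) = w := by
  obtain ⟨l', y, h1, h2, h3⟩ := φ.exists_lift h
  have h4 : FreeGroup.map φ.onE (FreeGroup.mk l') = FreeGroup.mk l := by
    rw [FreeGroup.map.mk, h3]
  have h5 := φ.monodromy_mk h1
  rw [h4] at h5
  have h6 : φ.monodromy (FreeGroup.mk l)⁻¹ x = y := by
    rw [map_inv, Equiv.Perm.inv_eq_iff_eq, h5]
  rw [h6]
  exact ⟨l', h1, h4, h2⟩

theorem onV_monodromy (φ : Hom G H) [Finite G.V] {y : G.V} {l : List (H.E × Bool)}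
    {u : H.V} (h : H.IsWalk u l (φ.onV y)) : φ.onV (φ.monodromy (FreeGroup.mk l) y) = u := by
  obtain ⟨-, -, -, h'⟩ := φ.exists_lift_monodromy h.invRev
  rwa [← FreeGroup.inv_mk, inv_inv] at h'

theorem onV_monodromy_inv (φ : Hom G H) [Finite G.V] {x : G.V} {l : List (H.E × Bool)}
    {w : H.V} (h : H.IsWalk (φ.onV x) l w) :
    φ.onV (φ.monodromy (FreeGroup.mk l)⁻¹ x) = w := by
  obtain ⟨-, -, -, h'⟩ := φ.exists_lift_monodromy h
  exact h'

/-- With respect to the numbering `f` of the fibre over `v`, the lift of `z i` that starts in `f j`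
ends in `f (σ i j)`. -/
def LiftsTo (φ : Hom G H) {v : H.V} {m n : ℕ} (z : Fin m → H.fundGroup v)
    (f : Fin n ≃ {x : G.V // φ.onV x = v}) (σ : Fin m → Equiv.Perm (Fin n)) : Prop :=
  ∀ i j, ∃ l, G.IsWalk (f j) l (f (σ i j)) ∧
    FreeGroup.map φ.onE (FreeGroup.mk l) = (z i : FreeGroup H.E)

variable {v : H.V} {m n : ℕ}

theorem liftsTo_iff (φ : Hom G H) [Finite G.V] (z : Fin m → H.fundGroup v)
    (f : Fin n ≃ {x : G.V // φ.onV x = v}) (σ : Fin m → Equiv.Perm (Fin n)) :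
    φ.LiftsTo z f σ ↔ ∀ i j, φ.monodromy (z i) (f (σ i j)) = f j := by
  refine forall₂_congr fun i j => ⟨fun ⟨l, hl, hz⟩ => hz ▸ φ.monodromy_mk hl, fun h => ?_⟩
  obtain ⟨l, hl, hz⟩ := (z i).2
  rw [← hz] at h ⊢
  obtain ⟨l', h1, h2, -⟩ := φ.exists_lift_monodromy (x := f j) (l := l) (w := v)
    (by rw [(f j).2]; exact hl)
  rw [← h, ← Equiv.Perm.mul_apply, ← map_mul, inv_mul_cancel, map_one, Equiv.Perm.one_apply, h]
    at h1
  exact ⟨l', h1, h2⟩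

/-- The action of the fundamental group on `Fin n` given by the permutations by which a free basis
acts. -/
def permHom {A : Type*} [Group A] (b : FreeGroup (Fin m) ≃* A)
    (σ : Fin m → Equiv.Perm (Fin n)) : A →* Equiv.Perm (Fin n) :=
  (FreeGroup.lift fun i => (σ i)⁻¹).comp b.symm.toMonoidHom

theorem permHom_basis {A : Type*} [Group A] (b : FreeGroup (Fin m) ≃* A)
    (σ : Fin m → Equiv.Perm (Fin n)) (i : Fin m) :
    permHom b σ (b (FreeGroup.of i)) = (σ i)⁻¹ := by
  simp [permHom]

variable (b : FreeGroup (Fin m) ≃* H.fundGroup v)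

theorem LiftsTo.monodromy_apply {φ : Hom G H} [Finite G.V]
    {f : Fin n ≃ {x : G.V // φ.onV x = v}} {σ : Fin m → Equiv.Perm (Fin n)}
    (h : φ.LiftsTo (fun i => b (FreeGroup.of i)) f σ) (g : H.fundGroup v) (k : Fin n) :
    φ.monodromy g (f k) = f (permHom b σ g k) := by
  obtain ⟨x, rfl⟩ := b.surjective g
  induction x using FreeGroup.induction_on generalizing k with
  | C1 => simp
  | of i =>
    have := (φ.liftsTo_iff _ f σ).1 h i ((σ i)⁻¹ k)
    rw [permHom_basis, ← this, ← Equiv.Perm.mul_apply (σ i), mul_inv_cancel]; rfl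
  | inv_of i ih =>
    rw [map_inv, map_inv, Subgroup.coe_inv, map_inv, Equiv.Perm.inv_eq_iff_eq, ih]
    simp
  | mul x y hx hy =>
    rw [map_mul, Subgroup.coe_mul, map_mul, map_mul, Equiv.Perm.mul_apply, hy, hx]
    rfl

/-- Every finite covering corresponds to some tuple. -/
theorem exists_liftsTo (φ : Hom G H) [Finite G.V] (z : Fin m → H.fundGroup v)
    (f : Fin n ≃ {x : G.V // φ.onV x = v}) : ∃ σ, φ.LiftsTo z f σ := by
  have hz : ∀ i x, φ.onV (φ.monodromy (z i) x) = v ↔ φ.onV x = v := by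
    intro i x
    obtain ⟨l, hl, hz⟩ := (z i).2
    rw [← hz]
    constructor
    · intro h
      have := φ.onV_monodromy_inv (x := φ.monodromy (FreeGroup.mk l) x) (l := l) (w := v)
        (by rw [h]; exact hl)
      rwa [← Equiv.Perm.mul_apply, ← map_mul, inv_mul_cancel, map_one] at this
    · intro h
      exact φ.onV_monodromy (by rw [h]; exact hl)
  refine ⟨fun i => f.symm.permCongr ((φ.monodromy (z i)).subtypePerm (hz i)).symm,
    (φ.liftsTo_iff _ _ _).2 fun i j => ?_⟩
  have h1 : ∀ y : {x : G.V // φ.onV x = v}, φ.monodromy (z i) y.1 =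
      ((φ.monodromy (z i)).subtypePerm (hz i) y).1 := fun _ => rfl
  rw [h1]
  simp [Equiv.permCongr_apply]

end Hom

section Model

variable {G₀ : AdequateGraph p q} {n : ℕ}

/-- The covering with vertex set `V × Fin n` whose sheets are glued by given permutations. -/
def glue (G₀ : AdequateGraph p q) (n : ℕ) (ρ : FreeGroup G₀.E →* Equiv.Perm (Fin n)) :
    AdequateGraph p q where
  V := G₀.V × Fin n
  E := G₀.E × Fin n
  s x := (G₀.s x.1, ρ (FreeGroup.of x.1) x.2)
  t x := (G₀.t x.1, x.2)
  color x := G₀.color x.1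
  outColor x := G₀.outColor x.1
  inColor x := G₀.inColor x.1
  bijOn_out := by
    rintro ⟨u, j⟩
    refine ⟨fun x hx => (G₀.bijOn_out u).mapsTo (congrArg Prod.fst hx), ?_, fun k hk => ?_⟩
    · rintro ⟨e, k⟩ he ⟨e', k'⟩ he' h
      obtain rfl : e = e' := (G₀.bijOn_out u).injOn (congrArg Prod.fst he)
        (congrArg Prod.fst he') h
      have h1 := (congrArg Prod.snd he).trans (congrArg Prod.snd he').symm
      exact congrArg (Prod.mk e) ((ρ (FreeGroup.of e)).injective h1)
    · obtain ⟨e, he, rfl⟩ := (G₀.bijOn_out u).surjOn hk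
      exact ⟨(e, (ρ (FreeGroup.of e)).symm j),
        Prod.ext he ((ρ (FreeGroup.of e)).apply_symm_apply j), rfl⟩
  bijOn_in := by
    rintro ⟨u, j⟩
    refine ⟨fun x hx => (G₀.bijOn_in u).mapsTo (congrArg Prod.fst hx), ?_, fun k hk => ?_⟩
    · rintro ⟨e, k⟩ he ⟨e', k'⟩ he' h
      obtain rfl : e = e' := (G₀.bijOn_in u).injOn (congrArg Prod.fst he)
        (congrArg Prod.fst he') h
      exact congrArg (Prod.mk e) ((congrArg Prod.snd he).trans (congrArg Prod.snd he').symm)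
    · obtain ⟨e, he, rfl⟩ := (G₀.bijOn_in u).surjOn hk
      exact ⟨(e, j), Prod.ext he rfl, rfl⟩

variable (ρ : FreeGroup G₀.E →* Equiv.Perm (Fin n))

/-- The projection of a glued covering. -/
def glueProj : Hom (G₀.glue n ρ) G₀ :=
  ⟨Prod.fst, Prod.fst, fun _ => rfl, fun _ => rfl, fun _ => rfl, fun _ => rfl, fun _ => rfl⟩

/-- The numbering of the fibres of a glued covering. -/
def glueFibre (v : G₀.V) : Fin n ≃ {x : (G₀.glue n ρ).V // (glueProj ρ).onV x = v} where
  toFun j := ⟨(v, j), rfl⟩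
  invFun x := x.1.2
  left_inv _ := rfl
  right_inv x := Subtype.ext (Prod.ext x.2.symm rfl)

theorem glueProj_isFold : (glueProj ρ).IsFold n := by
  refine ⟨Hom.isLocalIso _, fun w => ?_⟩
  have hf : Finite {x : (G₀.glue n ρ).V // (glueProj ρ).onV x = w} :=
    Finite.of_equiv _ (glueFibre ρ w)
  refine ⟨hf, ?_⟩
  have := Nat.card_congr (glueFibre ρ w)
  rw [Nat.card_fin] at this
  exact this.symm

theorem glue_isWalk {y : (G₀.glue n ρ).V} : ∀ {l : List ((G₀.glue n ρ).E × Bool)}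
    {x : (G₀.glue n ρ).V}, (G₀.glue n ρ).IsWalk x l y →
      ρ (FreeGroup.map (glueProj ρ).onE (FreeGroup.mk l)) y.2 = x.2
  | [], _, h => by
    cases h
    rw [← FreeGroup.one_eq_mk, map_one, map_one]; rfl
  | (e, true) :: l, _, h => by
    obtain ⟨rfl, h⟩ := h
    rw [FreeGroup.mk_cons_true, map_mul, map_mul, FreeGroup.map.of, Equiv.Perm.mul_apply,
      glue_isWalk h]
    rfl
  | (e, false) :: l, _, h => by
    obtain ⟨rfl, h⟩ := h
    rw [FreeGroup.mk_cons_false, map_mul, map_mul, map_inv, map_inv, FreeGroup.map.of,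
      Equiv.Perm.mul_apply, glue_isWalk h, Equiv.Perm.inv_eq_iff_eq]
    rfl

variable {v : G₀.V} {m : ℕ} (W : WalkSystem G₀ v) (b : FreeGroup (Fin m) ≃* G₀.fundGroup v)
  (σ : Fin m → Equiv.Perm (Fin n))

/-- The action of all edge words on the sheets of the covering that corresponds to a tuple. -/
def WalkSystem.sheetHom : FreeGroup G₀.E →* Equiv.Perm (Fin n) :=
  (Hom.permHom b σ).comp W.retraction

/-- Every tuple corresponds to a covering. -/
theorem glue_liftsTo : (glueProj (W.sheetHom b σ)).LiftsTo (fun i => b (FreeGroup.of i))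
    (glueFibre (W.sheetHom b σ) v) σ := by
  intro i j
  obtain ⟨l, hl, hz⟩ := (b (FreeGroup.of i)).2
  obtain ⟨l', y, h1, h2, h3⟩ := (glueProj (W.sheetHom b σ)).exists_lift
    (u := (glueFibre (W.sheetHom b σ) v j).1) (l := l) (w := v) hl
  have h4 : FreeGroup.map (glueProj (W.sheetHom b σ)).onE (FreeGroup.mk l') =
      (b (FreeGroup.of i) : FreeGroup G₀.E) := by
    rw [FreeGroup.map.mk, h3, hz]
  refine ⟨l', ?_, h4⟩
  have h5 := glue_isWalk _ h1
  rw [h4, WalkSystem.sheetHom, MonoidHom.comp_apply, W.retraction_coe, Hom.permHom_basis,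
    Equiv.Perm.inv_eq_iff_eq] at h5
  have : y = (glueFibre (W.sheetHom b σ) v (σ i j)).1 := Prod.ext h2 h5
  exact this ▸ h1

variable {b σ} {G : AdequateGraph p q} {φ : Hom G G₀}
  {f : Fin n ≃ {x : G.V // φ.onV x = v}}

/-- A covering that corresponds to a tuple is isomorphic to the glued covering. -/
theorem exists_iso_glue [Finite G.V] (h : φ.LiftsTo (fun i => b (FreeGroup.of i)) f σ) :
    ∃ α : Hom (G₀.glue n (W.sheetHom b σ)) G, α.IsIso ∧ ∀ j, α.onV (v, j) = f j := by
  have hV : ∀ u j, φ.onV (φ.monodromy (W.path u)⁻¹ (f j)) = u := fun u j =>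
    φ.onV_monodromy_inv (by rw [(f j).2]; exact W.isWalk u)
  let E (x : (G₀.glue n (W.sheetHom b σ)).E) : {ε // φ.onE ε = x.1} :=
    (φ.fibreEquivTarget x.1).symm ⟨_, hV (G₀.t x.1) x.2⟩
  have ht : ∀ x, G.t (E x).1 = φ.monodromy (W.path (G₀.t x.1))⁻¹ (f x.2) := fun x =>
    congrArg Subtype.val ((φ.fibreEquivTarget x.1).apply_symm_apply ⟨_, hV (G₀.t x.1) x.2⟩)
  have hs : ∀ x, G.s (E x).1 = φ.monodromy (W.path (G₀.s x.1))⁻¹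
      (f (W.sheetHom b σ (FreeGroup.of x.1) x.2)) := by
    intro x
    rw [← φ.monodromy_of, ht, (E x).2, WalkSystem.sheetHom, MonoidHom.comp_apply,
      ← h.monodromy_apply, W.retraction_of, WalkSystem.loop, ← Equiv.Perm.mul_apply,
      ← Equiv.Perm.mul_apply, ← map_mul, ← map_mul]
    group
  refine ⟨⟨fun x => φ.monodromy (W.path x.1)⁻¹ (f x.2), fun x => (E x).1, fun x => (hs x).symm,
    fun x => (ht x).symm, fun x => ?_, fun x => ?_, fun x => ?_⟩,
    Hom.isIso_of_bijective _ ⟨?_, fun y => ?_⟩, fun j => ?_⟩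
  · rw [← φ.map_color, hV]; rfl
  · rw [← φ.map_outColor, (E x).2]; rfl
  · rw [← φ.map_inColor, (E x).2]; rfl
  · rintro ⟨u, j⟩ ⟨u', j'⟩ h'
    have h1 : φ.monodromy (W.path u)⁻¹ (f j) = φ.monodromy (W.path u')⁻¹ (f j') := h'
    obtain rfl : u = u' := by rw [← hV u j, h1, hV]
    exact congrArg (Prod.mk u) (f.injective (Subtype.ext ((φ.monodromy _).injective h1)))
  · have h1 : φ.onV (φ.monodromy (W.path (φ.onV y)) y) = v := φ.onV_monodromy (W.isWalk _)
    refine ⟨(φ.onV y, f.symm ⟨_, h1⟩), ?_⟩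
    simp
  · simp [W.path_base]

variable {G' : AdequateGraph p q} {φ' : Hom G' G₀}
  {f' : Fin n ≃ {x : G'.V // φ'.onV x = v}} {σ' : Fin m → Equiv.Perm (Fin n)}

theorem Hom.LiftsTo.reindex {m : ℕ} {z : Fin m → G₀.fundGroup v}
    {σ σ' : Fin m → Equiv.Perm (Fin n)} (h : φ.LiftsTo z f σ')
    {τ : Equiv.Perm (Fin n)} (hτ : ∀ i, τ * σ i = σ' i * τ) : φ.LiftsTo z (τ.trans f) σ := by
  intro i j
  obtain ⟨l, h1, h2⟩ := h i (τ j)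
  refine ⟨l, ?_, h2⟩
  have := DFunLike.congr_fun (hτ i) j
  simp only [Equiv.Perm.mul_apply] at this
  simpa [this] using h1

/-- Coverings that correspond to conjugate tuples are isomorphic. -/
theorem exists_iso_of_conj [Finite G.V] [Finite G'.V] (W : WalkSystem G₀ v)
    (h : φ.LiftsTo (fun i => b (FreeGroup.of i)) f σ)
    (h' : φ'.LiftsTo (fun i => b (FreeGroup.of i)) f' σ') {τ : Equiv.Perm (Fin n)}
    (hτ : ∀ i, τ * σ i = σ' i * τ) :
    ∃ α : Hom G G', α.IsIso ∧ ∀ j, α.onV (f j) = f' (τ j) := by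
  obtain ⟨α, hα, h1⟩ := exists_iso_glue W h
  obtain ⟨β, hβ, h2⟩ := exists_iso_glue W (h'.reindex hτ)
  refine ⟨β.comp (α.inv hα), hβ.comp hα.inv, fun j => ?_⟩
  have h3 : (α.inv hα).onV (f j) = (v, j) := by
    rw [← h1]
    exact (Equiv.ofBijective α.onV hα.1).symm_apply_apply _
  exact (congrArg β.onV h3).trans (h2 j)

/-- An injective morphism over the base conjugates the corresponding tuples. -/
theorem exists_conj_of_hom [Finite G'.V] {m : ℕ} {z : Fin m → G₀.fundGroup v}
    {σ σ' : Fin m → Equiv.Perm (Fin n)} (h : φ.LiftsTo z f σ) (h' : φ'.LiftsTo z f' σ')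
    (α : Hom G G') (hα : Function.Injective α.onV) (hc : φ'.comp α = φ) :
    ∃ τ : Equiv.Perm (Fin n), (∀ j, α.onV (f j) = f' (τ j)) ∧ ∀ i, τ * σ i = σ' i * τ := by
  subst hc
  let t : Fin n → Fin n := fun j => f'.symm ⟨α.onV (f j), (f j).2⟩
  have ht : ∀ j, α.onV (f j) = f' (t j) := fun j => by simp [t]
  have hinj : Function.Injective t := fun j k hjk =>
    f.injective (Subtype.ext (hα (by rw [ht, ht, hjk])))
  refine ⟨Equiv.ofBijective t (Finite.injective_iff_bijective.1 hinj), ht, fun i => ?_⟩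
  ext1 j
  refine f'.injective (Subtype.ext ((φ'.monodromy (z i)).injective ?_))
  obtain ⟨l, h1, h2⟩ := h i j
  have h3 := φ'.monodromy_mk (α.isWalk_map h1)
  rw [← FreeGroup.map.mk, FreeGroup.map.comp] at h3
  change φ'.monodromy (FreeGroup.map (φ'.onE ∘ α.onE) (FreeGroup.mk l)) _ = _ at h3
  change FreeGroup.map (φ'.onE ∘ α.onE) (FreeGroup.mk l) = _ at h2
  rw [h2, ht, ht] at h3
  exact h3.trans ((φ'.liftsTo_iff z f' σ').1 h' i (t j)).symm

/-- A morphism is determined by its values on one fibre. -/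
theorem Hom.ext_fibre (hG₀ : G₀.Connected) (φ : Hom G G₀) (v : G₀.V) {α β : Hom G G'}
    (h : ∀ x, φ.onV x = v → α.onV x = β.onV x) : α = β := by
  refine Hom.ext_onV (funext fun x => ?_)
  obtain ⟨l, hl⟩ := hG₀.2 (φ.onV x) v
  obtain ⟨l', y, h1, h2, -⟩ := φ.exists_lift hl
  exact Hom.eq_of_isWalk α β h1.invRev (h y h2)

theorem card_aut [Finite G.V] (hG₀ : G₀.Irreducible)
    (h : φ.LiftsTo (fun i => b (FreeGroup.of i)) f σ) :
    Nat.card {α : Hom G G // α.IsIso} =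
      Nat.card {τ : Equiv.Perm (Fin n) // ∀ i, τ * σ i = σ i * τ} := by
  obtain ⟨W⟩ := hG₀.2.1.nonempty_walkSystem v
  choose g hg hgf using fun τ : {τ : Equiv.Perm (Fin n) // ∀ i, τ * σ i = σ i * τ} =>
    exists_iso_of_conj W h h τ.2
  refine (Nat.card_eq_of_bijective (fun τ => ⟨g τ, hg τ⟩) ⟨fun τ τ' hτ => ?_, ?_⟩).symm
  · refine Subtype.ext (Equiv.ext fun j => f.injective (Subtype.ext ?_))
    have h1 : g τ = g τ' := congrArg Subtype.val hτ
    rw [← hgf, ← hgf, h1]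
  · rintro ⟨α, hα⟩
    obtain ⟨τ, h1, h2⟩ := exists_conj_of_hom h h α hα.1.1 (hG₀.hom_eq _ _)
    refine ⟨⟨τ, h2⟩, Subtype.ext (Hom.ext_fibre hG₀.2.1 φ v fun x hx => ?_)⟩
    obtain ⟨j, hj⟩ := f.surjective ⟨x, hx⟩
    obtain rfl : (f j).1 = x := congrArg Subtype.val hj
    exact (hgf ⟨τ, h2⟩ j).trans (h1 j).symm

end Model

end AdequateGraph

section Correspondence

variable {r : ℕ} {p q : Fin r → ℕ} {Γ₀ : FinGraph p q} {v : Γ₀.1.V} {m n : ℕ}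

theorem exists_correspondsTo {Γ : FinGraph p q} {φ : Hom Γ.1 Γ₀.1} (hφ : φ.IsFold n)
    (z : Fin m → Γ₀.1.fundGroup v) :
    ∃ σ : Fin m → Equiv.Perm (Fin n), CorrespondsTo z Γ.1 σ := by
  have := Γ.2.1
  have h : Nat.card {x : Γ.1.V // φ.onV x = v} = n := (hφ.2 v).2
  have f : Fin n ≃ {x : Γ.1.V // φ.onV x = v} := (Finite.equivFinOfCardEq h).symm
  obtain ⟨σ, hσ⟩ := φ.exists_liftsTo z f
  exact ⟨σ, φ, hφ, f, hσ⟩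

theorem exists_correspondsTo_of_tuple (hΓ₀ : Γ₀.1.Connected)
    (b : FreeGroup (Fin m) ≃* Γ₀.1.fundGroup v) (σ : Fin m → Equiv.Perm (Fin n)) :
    ∃ Γ : FinGraph p q, CorrespondsTo (fun i => b (FreeGroup.of i)) Γ.1 σ := by
  obtain ⟨W⟩ := hΓ₀.nonempty_walkSystem v
  have := Γ₀.2.1
  have := Γ₀.2.2
  exact ⟨⟨Γ₀.1.glue n (W.sheetHom b σ), inferInstanceAs (Finite (Γ₀.1.V × Fin n)),
    inferInstanceAs (Finite (Γ₀.1.E × Fin n))⟩, _, glueProj_isFold _, _, glue_liftsTo W b σ⟩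

theorem CorrespondsTo.mk_eq_of_conj (hΓ₀ : Γ₀.1.Connected)
    {b : FreeGroup (Fin m) ≃* Γ₀.1.fundGroup v} {Γ Γ' : FinGraph p q}
    {σ σ' : Fin m → Equiv.Perm (Fin n)}
    (h : CorrespondsTo (fun i => b (FreeGroup.of i)) Γ.1 σ)
    (h' : CorrespondsTo (fun i => b (FreeGroup.of i)) Γ'.1 σ') {τ : Equiv.Perm (Fin n)}
    (hτ : ∀ i, τ * σ i = σ' i * τ) : GraphClass.mk Γ = GraphClass.mk Γ' := by
  obtain ⟨W⟩ := hΓ₀.nonempty_walkSystem v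
  have := Γ.2.1
  have := Γ'.2.1
  obtain ⟨φ, -, f, hf⟩ := h
  obtain ⟨φ', -, f', hf'⟩ := h'
  obtain ⟨α, hα, -⟩ := exists_iso_of_conj W hf hf' hτ
  exact Quotient.sound ⟨α, hα⟩

theorem CorrespondsTo.exists_conj_of_mk_eq (hΓ₀ : Γ₀.1.Irreducible)
    {z : Fin m → Γ₀.1.fundGroup v} {Γ Γ' : FinGraph p q} {σ σ' : Fin m → Equiv.Perm (Fin n)}
    (h : CorrespondsTo z Γ.1 σ) (h' : CorrespondsTo z Γ'.1 σ')
    (he : GraphClass.mk Γ = GraphClass.mk Γ') :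
    ∃ τ : Equiv.Perm (Fin n), ∀ i, τ * σ i = σ' i * τ := by
  have := Γ'.2.1
  obtain ⟨φ, -, f, hf⟩ := h
  obtain ⟨φ', -, f', hf'⟩ := h'
  obtain ⟨α, hα⟩ := Quotient.exact he
  obtain ⟨τ, -, hτ⟩ := exists_conj_of_hom hf hf' α hα.1.1 (hΓ₀.hom_eq _ _)
  exact ⟨τ, hτ⟩

theorem CorrespondsTo.autCard_eq (hΓ₀ : Γ₀.1.Irreducible)
    {b : FreeGroup (Fin m) ≃* Γ₀.1.fundGroup v} {Γ : FinGraph p q}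
    {σ : Fin m → Equiv.Perm (Fin n)}
    (h : CorrespondsTo (fun i => b (FreeGroup.of i)) Γ.1 σ) :
    (GraphClass.mk Γ).autCard =
      Nat.card {τ : Equiv.Perm (Fin n) // ∀ i, τ * σ i = σ i * τ} := by
  have := Γ.2.1
  obtain ⟨φ, -, f, hf⟩ := h
  exact card_aut hΓ₀ hf

/-- The fibre of a disjoint union. -/
def fibreSumEquiv {G H L : AdequateGraph p q} (φ : Hom G L) (ψ : Hom H L) (v : L.V) :
    {x // φ.onV x = v} ⊕ {x // ψ.onV x = v} ≃ {x : (G.sum H).V // (φ.sumElim ψ).onV x = v} :=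
  (Equiv.subtypeSum (p := fun x : G.V ⊕ H.V => (φ.sumElim ψ).onV x = v)).symm

theorem CorrespondsTo.sum {G H L : AdequateGraph p q} {v : L.V} {a b : ℕ}
    {z : Fin m → L.fundGroup v} {σ : Fin m → Equiv.Perm (Fin a)}
    {τ : Fin m → Equiv.Perm (Fin b)} (hG : CorrespondsTo z G σ) (hH : CorrespondsTo z H τ) :
    CorrespondsTo z (G.sum H) fun i => juxtapose (σ i) (τ i) := by
  obtain ⟨φ, hφ, f, hf⟩ := hG
  obtain ⟨ψ, hψ, g, hg⟩ := hH
  refine ⟨φ.sumElim ψ, hφ.sumElim hψ,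
    finSumFinEquiv.symm.trans ((Equiv.sumCongr f g).trans (fibreSumEquiv φ ψ v)), fun i j => ?_⟩
  obtain ⟨j | j, rfl⟩ := finSumFinEquiv.surjective j
  · obtain ⟨l, h1, h2⟩ := hf i j
    refine ⟨l.map fun x => ((sumInl G H).onE x.1, x.2), ?_, ?_⟩
    · simp only [juxtapose, Equiv.permCongr_apply, Equiv.trans_apply, Equiv.symm_apply_apply,
        Equiv.sumCongr_apply, Sum.map_inl]
      exact (sumInl G H).isWalk_map h1
    · rw [← FreeGroup.map.mk, FreeGroup.map.comp]
      exact h2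
  · obtain ⟨l, h1, h2⟩ := hg i j
    refine ⟨l.map fun x => ((sumInr G H).onE x.1, x.2), ?_, ?_⟩
    · simp only [juxtapose, Equiv.permCongr_apply, Equiv.trans_apply, Equiv.symm_apply_apply,
        Equiv.sumCongr_apply, Sum.map_inr]
      exact (sumInr G H).isWalk_map h1
    · rw [← FreeGroup.map.mk, FreeGroup.map.comp]
      exact h2

end Correspondence

section Coinvariants

variable (K : Type*) [Field K] {m n : ℕ}

theorem diagConj_of (σ : Fin m → Equiv.Perm (Fin n)) (τ : Equiv.Perm (Fin n)) :
    diagConj K m n τ (MonoidAlgebra.of K _ σ) =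
      MonoidAlgebra.of K _ fun i => τ * σ i * τ⁻¹ :=
  Representation.ofMulAction_single (k := K) (G := ConjAct (Equiv.Perm (Fin n)))
    (H := Fin m → Equiv.Perm (Fin n)) (ConjAct.toConjAct τ) σ 1

theorem tupleClass_eq_of_conj {σ σ' : Fin m → Equiv.Perm (Fin n)} {τ : Equiv.Perm (Fin n)}
    (h : ∀ i, τ * σ i = σ' i * τ) : tupleClass K σ = tupleClass K σ' := by
  have h1 : diagConj K m n τ (MonoidAlgebra.of K _ σ) = MonoidAlgebra.of K _ σ' := by
    simp only [diagConj_of, h, mul_inv_cancel_right]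
  have h2 := Representation.Coinvariants.sub_mem_ker (ρ := diagConj K m n) τ
    (MonoidAlgebra.of K _ σ)
  rw [h1] at h2
  exact ((Representation.Coinvariants.mk_eq_iff _).2 h2).symm

theorem span_tupleClass :
    Submodule.span K (Set.range (tupleClass K : (Fin m → Equiv.Perm (Fin n)) → _)) = ⊤ := by
  have h := (MonoidAlgebra.basis (Fin m → Equiv.Perm (Fin n)) K).span_eq
  have h1 := congrArg (Submodule.map (Representation.Coinvariants.mk (diagConj K m n))) h
  rw [Submodule.map_span, ← Set.range_comp, Submodule.map_top, LinearMap.range_eq_top.2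
    (Representation.Coinvariants.mk_surjective _)] at h1
  exact h1

/-- Linear maps on the coinvariants are given by conjugation invariant functions of tuples. -/
theorem exists_coinvariants_lift {M : Type*} [AddCommGroup M] [Module K M]
    (g : (Fin m → Equiv.Perm (Fin n)) → M)
    (hg : ∀ (τ : Equiv.Perm (Fin n)) σ σ', (∀ i, τ * σ i = σ' i * τ) → g σ = g σ') :
    ∃ F : (diagConj K m n).Coinvariants →ₗ[K] M, ∀ σ, F (tupleClass K σ) = g σ := by
  have hb : ∀ σ, (MonoidAlgebra.basis (Fin m → Equiv.Perm (Fin n)) K).constr K g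
      (MonoidAlgebra.of K _ σ) = g σ := fun σ =>
    (MonoidAlgebra.basis (Fin m → Equiv.Perm (Fin n)) K).constr_basis K g σ
  refine ⟨Representation.Coinvariants.lift _
    ((MonoidAlgebra.basis (Fin m → Equiv.Perm (Fin n)) K).constr K g) fun τ => ?_, hb⟩
  refine (MonoidAlgebra.basis (Fin m → Equiv.Perm (Fin n)) K).ext fun σ => ?_
  change (MonoidAlgebra.basis _ K).constr K g (diagConj K m n τ (MonoidAlgebra.of K _ σ)) =
    (MonoidAlgebra.basis _ K).constr K g (MonoidAlgebra.of K _ σ)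
  rw [diagConj_of, hb, hb]
  exact (hg τ _ _ fun i => (inv_mul_cancel_right _ _).symm).symm

variable {r : ℕ} {p q : Fin r → ℕ} {Γ₀ : FinGraph p q} {v : Γ₀.1.V}

/-- The coinvariants of the tuples of permutations are the span of the `n`-fold coverings. -/
theorem exists_coinvariants_equiv (hΓ₀ : Γ₀.1.Irreducible)
    (b : FreeGroup (Fin m) ≃* Γ₀.1.fundGroup v) (n : ℕ) :
    ∃ Φ : (diagConj K m n).Coinvariants ≃ₗ[K] KX.gradedPiece K (GraphClass.mk Γ₀) n,
      ∀ (Γ : FinGraph p q) (σ : Fin m → Equiv.Perm (Fin n)),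
        CorrespondsTo (fun i => b (FreeGroup.of i)) Γ.1 σ →
        ((Φ (tupleClass K σ) : KX.piece K (GraphClass.mk Γ₀)) : KX K p q) = KX.diag K Γ := by
  classical
  have hc := hΓ₀.2.1
  let P (Γ : FinGraph p q) (σ : Fin m → Equiv.Perm (Fin n)) : Prop :=
    CorrespondsTo (fun i => b (FreeGroup.of i)) Γ.1 σ
  choose cov hcov using fun σ : Fin m → Equiv.Perm (Fin n) => exists_correspondsTo_of_tuple hc b σ
  have hmem : ∀ σ, GraphClass.mk (cov σ) ∈ GraphClass.diagramsOver Γ₀ := fun σ =>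
    ⟨_, rfl, ⟨(hcov σ).choose⟩⟩
  let g (σ : Fin m → Equiv.Perm (Fin n)) : KX.gradedPiece K (GraphClass.mk Γ₀) n :=
    ⟨⟨KX.diag K (cov σ), KX.of_mem_piece K hc (hmem σ)⟩, Submodule.subset_span
      ⟨cov σ, Γ₀, rfl, (hcov σ).imp fun _ h => h.1, rfl⟩⟩
  obtain ⟨F, hF⟩ := exists_coinvariants_lift K g fun τ σ σ' h =>
    Subtype.ext (Subtype.ext (congrArg (MonoidAlgebra.of K _)
      ((hcov σ).mk_eq_of_conj hc (hcov σ') h)))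
  have hFd : ∀ (Γ : FinGraph p q) (σ : Fin m → Equiv.Perm (Fin n)), P Γ σ →
      ((F (tupleClass K σ) : KX.piece K (GraphClass.mk Γ₀)) : KX K p q) = KX.diag K Γ := by
    intro Γ σ h
    rw [hF]
    exact congrArg (MonoidAlgebra.of K _)
      ((hcov σ).mk_eq_of_conj hc h (τ := 1) fun i => by rw [one_mul, mul_one])
  let back (c : GraphClass p q) : (diagConj K m n).Coinvariants :=
    if h : ∃ σ Γ, P Γ σ ∧ GraphClass.mk Γ = c then tupleClass K h.choose else 0
  have hback : ∀ Γ σ, P Γ σ → back (GraphClass.mk Γ) = tupleClass K σ := by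
    intro Γ σ h
    have h1 : ∃ σ' Γ', P Γ' σ' ∧ GraphClass.mk Γ' = GraphClass.mk Γ := ⟨σ, Γ, h, rfl⟩
    obtain ⟨Γ', h2, h3⟩ := h1.choose_spec
    obtain ⟨τ, hτ⟩ := CorrespondsTo.exists_conj_of_mk_eq hΓ₀ h2 h h3
    exact (dif_pos h1).trans (tupleClass_eq_of_conj K hτ)
  let B : KX K p q →ₗ[K] (diagConj K m n).Coinvariants :=
    (MonoidAlgebra.basis (GraphClass p q) K).constr K back
  have hB : ∀ c, B (MonoidAlgebra.of K _ c) = back c := fun c =>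
    (MonoidAlgebra.basis (GraphClass p q) K).constr_basis K back c
  have hleft : ∀ x, B (F x : KX.piece K (GraphClass.mk Γ₀)) = x := by
    intro x
    have hx : x ∈ Submodule.span K
        (Set.range (tupleClass K : (Fin m → Equiv.Perm (Fin n)) → _)) := by
      rw [span_tupleClass]; trivial
    induction hx using Submodule.span_induction with
    | mem x hx =>
      obtain ⟨σ, rfl⟩ := hx
      rw [hFd _ σ (hcov σ), KX.diag, hB, hback _ σ (hcov σ)]
    | zero => simp
    | add x y _ _ hx hy => simp [hx, hy]
    | smul k x _ hx => simp [hx]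
  refine ⟨LinearEquiv.ofBijective F ⟨fun x y h => by rw [← hleft x, h, hleft], ?_⟩, hFd⟩
  have hsurj : KX.gradedPiece K (GraphClass.mk Γ₀) n ≤
      (LinearMap.range F).map (KX.gradedPiece K (GraphClass.mk Γ₀) n).subtype := by
    refine Submodule.span_le.2 ?_
    rintro x ⟨Γ, Γ₀', h, hφ, hx⟩
    obtain ⟨φ, hφ⟩ := GraphClass.exists_isFold_iff.1 ⟨Γ₀', h, hφ⟩
    obtain ⟨σ, hσ⟩ := exists_correspondsTo hφ fun i => b (FreeGroup.of i)
    exact ⟨_, ⟨tupleClass K σ, rfl⟩, Subtype.ext ((hFd Γ σ hσ).trans hx.symm)⟩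
  rintro ⟨x, hx⟩
  obtain ⟨y, ⟨w, rfl⟩, hy⟩ := hsurj hx
  exact ⟨w, Subtype.ext hy⟩

end Coinvariants

theorem KX.form_diag {K : Type*} [Field K] (conj : K ≃+* K) {r : ℕ} {p q : Fin r → ℕ}
    (Γ : FinGraph p q) : form conj (diag K Γ) (diag K Γ) = ((GraphClass.mk Γ).autCard : K) := by
  simp [form, diag, Finsupp.sum_single_index]

end

theorem mainTheorem3 {K : Type*} [Field K] [IsAlgClosed K] [CharZero K]
    (conj : K ≃+* K) (hconj : ∀ a, conj (conj a) = a)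
    (hroots : ∀ (a : K) (k : ℕ), 0 < k → a ^ k = 1 → conj a = a⁻¹)
    {r : ℕ} (p q : Fin r → ℕ) :
    -- tensor product decomposition over all irreducible graphs
    (∃ e : algTensor K (fun c : IrrClass p q => KX.piece K c.1) ≃ₐ[K] KX K p q,
      ∀ (c : IrrClass p q) (x : KX.piece K c.1),
        e (algTensor.incl K (fun c : IrrClass p q => KX.piece K c.1) c x) = x) ∧
    ∀ Γ₀ : FinGraph p q, Γ₀.1.Irreducible →
      -- the factor is a polynomial algebra on the connected graphs covering `Γ₀`
      AlgebraicIndependent K (fun c : (GraphClass.mk Γ₀).connectedCovers =>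
        MonoidAlgebra.of K (GraphClass p q) c) ∧
      -- the factor is graded by `ℕ`, compatibly with the degrees in `K[X]`
      SetLike.GradedMonoid (KX.gradedPiece K (GraphClass.mk Γ₀)) ∧
      DirectSum.IsInternal (KX.gradedPiece K (GraphClass.mk Γ₀)) ∧
      (∀ n, ∀ x ∈ KX.gradedPiece K (GraphClass.mk Γ₀) n,
        (x : KX K p q) ∈
          KX.homogeneous K p q (fun a => n * {w | Γ₀.1.color w = a}.ncard)) ∧
      ∀ v : Γ₀.1.V,
        -- the fundamental group is free of finite rank
        (∃ m : ℕ, Nonempty (FreeGroup (Fin m) ≃* Γ₀.1.fundGroup v)) ∧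
        ∀ (m : ℕ) (b : FreeGroup (Fin m) ≃* Γ₀.1.fundGroup v),
          -- every `n`-fold covering corresponds to a tuple, and every tuple to a covering
          (∀ (n : ℕ) (Γ : FinGraph p q), (∃ φ : AdequateGraph.Hom Γ.1 Γ₀.1, φ.IsFold n) →
            ∃ σ : Fin m → Equiv.Perm (Fin n),
              CorrespondsTo (fun i => b (FreeGroup.of i)) Γ.1 σ) ∧
          (∀ (n : ℕ) (σ : Fin m → Equiv.Perm (Fin n)), ∃ Γ : FinGraph p q,
            CorrespondsTo (fun i => b (FreeGroup.of i)) Γ.1 σ) ∧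
          -- squared norms are orders of centralizers
          (∀ (n : ℕ) (Γ : FinGraph p q) (σ : Fin m → Equiv.Perm (Fin n)),
            CorrespondsTo (fun i => b (FreeGroup.of i)) Γ.1 σ →
            KX.form conj (KX.diag K Γ) (KX.diag K Γ) =
              (Nat.card {τ : Equiv.Perm (Fin n) // ∀ i, τ * σ i = σ i * τ} : K)) ∧
          ∃ Φ : ∀ n : ℕ, (diagConj K m n).Coinvariants ≃ₗ[K]
              KX.gradedPiece K (GraphClass.mk Γ₀) n,
            -- the isomorphism matches tuples with the corresponding coverings
            (∀ (n : ℕ) (Γ : FinGraph p q) (σ : Fin m → Equiv.Perm (Fin n)),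
              CorrespondsTo (fun i => b (FreeGroup.of i)) Γ.1 σ →
              ((Φ n (tupleClass K σ) : KX.piece K (GraphClass.mk Γ₀)) : KX K p q) =
                KX.diag K Γ) ∧
            -- multiplication is juxtaposition of tuples
            ∀ (n₁ n₂ : ℕ) (σ : Fin m → Equiv.Perm (Fin n₁)) (τ : Fin m → Equiv.Perm (Fin n₂)),
              (Φ n₁ (tupleClass K σ) : KX.piece K (GraphClass.mk Γ₀)) *
                  (Φ n₂ (tupleClass K τ) : KX.piece K (GraphClass.mk Γ₀)) =
                (Φ (n₁ + n₂) (tupleClass K (fun i => juxtapose (σ i) (τ i))) :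
                  KX.piece K (GraphClass.mk Γ₀)) := by
  refine ⟨KX.exists_algTensor_equiv K, fun Γ₀ hΓ₀ =>
    ⟨KX.algebraicIndependent_connectedCovers K _, KX.gradedPiece_gradedMonoid K _,
      KX.gradedPiece_isInternal K hΓ₀, KX.gradedPiece_homogeneous K Γ₀, fun v => ⟨?_, fun m b =>
        ⟨fun n Γ ⟨φ, hφ⟩ => exists_correspondsTo hφ _,
          fun n σ => exists_correspondsTo_of_tuple hΓ₀.2.1 b σ, fun n Γ σ h => ?_, ?_⟩⟩⟩⟩
  · have := Γ₀.2.2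
    exact hΓ₀.2.1.exists_fundGroup_equiv v
  · rw [KX.form_diag, h.autCard_eq hΓ₀]
  · choose Φ hΦ using exists_coinvariants_equiv K hΓ₀ b
    refine ⟨Φ, hΦ, fun n₁ n₂ σ τ => Subtype.ext ?_⟩
    obtain ⟨Γ, hΓ⟩ := exists_correspondsTo_of_tuple hΓ₀.2.1 b σ
    obtain ⟨Γ', hΓ'⟩ := exists_correspondsTo_of_tuple hΓ₀.2.1 b τ
    have := Γ.2.1
    have := Γ.2.2
    have := Γ'.2.1
    have := Γ'.2.2
    rw [MulMemClass.coe_mul, hΦ n₁ Γ σ hΓ, hΦ n₂ Γ' τ hΓ',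
      hΦ (n₁ + n₂) ⟨Γ.1.sum Γ'.1, inferInstanceAs (Finite (Γ.1.V ⊕ Γ'.1.V)),
        inferInstanceAs (Finite (Γ.1.E ⊕ Γ'.1.E))⟩ _ (hΓ.sum hΓ')]
    exact (map_mul (MonoidAlgebra.of K (GraphClass p q)) (GraphClass.mk Γ)
      (GraphClass.mk Γ')).symm
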